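/- Let $0<\alpha<1$, $\kappa>0$ and $\delta>0$. There are constants $c_0,c_1,c_2,c_3>0$, depending only on $\kappa,\delta,\alpha$, for which the following holds. Let $\xi$ be a symmetric real random variable with variance $1$ satisfying $\Pr(|\xi|\ge\kappa)\ge\delta$, let $n\ge 1$ and $N\ge c_1 n$ be integers, let $\Gamma$ be an $N\times n$ random matrix whose entries are independent copies of $\xi$, and let $X_1,\dots,X_N$ be the rows of $\Gamma$. Put $$L=B_\infty^n\cap\sqrt{\log(eN/n)}\,B_2^n,\qquad L^\circ=\{z\in\mathbb R^n:\ |\langle x,z\rangle|\le 1\ \text{ for all } x\in L\},$$ where $B_\infty^n=[-1,1]^n$ and $B_2^n$ is the Euclidean unit ball. Then, with probability at least $1-2\exp(-c_2N^{1-\alpha}n^{\alpha})$, both of the following hold: $$c_3L\subset\mathrm{absconv}(X_1,\dots,X_N),$$ where $\mathrm{absconv}$ denotes the absolute convex hull, and, for every $z$ in the boundary $\partial L^\circ$, $$\bigl|\{i\in\{1,\dots,N\}:\ |\langle z,X_i\rangle|\ge c_0\}\bigr|\ \ge\ N^{1-\alpha}n^{\alpha}.$$ -/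

import Mathlib

open MeasureTheory ProbabilityTheory
open scoped Pointwise

namespace RandomPolytope

/-- A real random variable is symmetric if it has the same distribution as its negative. -/
def IsSymmetric {Ω : Type*} [MeasurableSpace Ω] (ξ : Ω → ℝ) (P : Measure Ω) : Prop :=
  IdentDistrib ξ (fun ω => -ξ ω) P P

/-- The small-ball condition `Pr(|ξ| ≥ κ) ≥ δ`. -/
def SmallBall {Ω : Type*} [MeasurableSpace Ω] (ξ : Ω → ℝ) (P : Measure Ω) (κ δ : ℝ) : Prop :=
  δ ≤ P.real {ω | κ ≤ |ξ ω|}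

/-- `Γ` is a random `N × n` matrix whose entries are independent copies of `ξ`. -/
structure HasIIDEntries {Ω Ω' : Type*} [MeasurableSpace Ω] [MeasurableSpace Ω'] {N n : ℕ}
    (Γ : Ω → Matrix (Fin N) (Fin n) ℝ) (P : Measure Ω) (ξ : Ω' → ℝ) (P' : Measure Ω') :
    Prop where
  indep : iIndepFun (fun (p : Fin N × Fin n) (ω : Ω) => Γ ω p.1 p.2) P
  identDistrib : ∀ i j, IdentDistrib (fun ω => Γ ω i j) ξ P P'

/-- The `i`-th row of a matrix, as a vector of the Euclidean space `ℝⁿ`. -/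
def rowVec {N n : ℕ} (A : Matrix (Fin N) (Fin n) ℝ) (i : Fin N) : EuclideanSpace ℝ (Fin n) :=
  WithLp.toLp 2 (A i)

/-- The unit cube `B_∞ⁿ = [-1, 1]ⁿ`. -/
def cube (n : ℕ) : Set (EuclideanSpace ℝ (Fin n)) :=
  {x | ∀ j, |x j| ≤ 1}

/-- The Euclidean unit ball `B_2ⁿ`. -/
def euclideanBall (n : ℕ) : Set (EuclideanSpace ℝ (Fin n)) :=
  Metric.closedBall 0 1

/-- The convex body `L = B_∞ⁿ ∩ √(log (e N / n)) B_2ⁿ`. -/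
noncomputable def body (N n : ℕ) : Set (EuclideanSpace ℝ (Fin n)) :=
  cube n ∩ √(Real.log (Real.exp 1 * N / n)) • euclideanBall n

/-- The dual (polar) body of `L`. The polar taken here is the absolute one,
`{z | ∀ x ∈ L, |⟪x, z⟫| ≤ 1}`, which is the usual polar since `L = -L`. -/
noncomputable def dualBody (N n : ℕ) : Set (EuclideanSpace ℝ (Fin n)) :=
  (innerₗ (EuclideanSpace ℝ (Fin n))).polar (body N n)

end RandomPolytope

/-!
For a single `y ∈ ℝⁿ` in the unit ball with `⟨v, y⟩ ≥ 1/2` for some `v ∈ L`, a lower bound on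
`P(|⟨y, X⟩| ≥ c)` comes from a change of measure. Tilt the law of the `j`-th entry by the density
`1 + η v_j σ`, where `σ` is the sign truncated at `κ`. As `σ` is odd, second moments do not change,
while `⟨y, X⟩` acquires a mean of at least `κ δ η / 2`, so the event has tilted probability bounded
below (Paley–Zygmund). By Cauchy–Schwarz, returning to the original law costs a factor of at most
`exp(η² ‖v‖²) ≤ exp(η² log(eN/n))`; with `η² = α/2` this is `O((N/n)^(α/2))`, so that the original
probability is at least `4 (N/n)^(-α)` once `N/n` is large.

A Chernoff bound and a union bound then give the count for all points of a lattice net at once. To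
pass from `z` to the net, round its coordinates one after the other, each up or down according to
the error accumulated so far: this keeps the sum of the squared errors of the `⟨z, X_i⟩` over the
short rows as small as for random rounding, and there are few long rows. Points of `∂L°` are of the
above kind, and Hahn–Banach turns the count on `∂L°` into the inclusion.
-/

namespace RandomPolytope

section SecondMoment

variable {Ω : Type*} [MeasurableSpace Ω] {μ : Measure Ω} {f : Ω → ℝ}

lemma sq_setIntegral_le [IsFiniteMeasure μ] (hf : MemLp f 2 μ) (s : Set Ω) :
    (∫ x in s, f x ∂μ) ^ 2 ≤ μ.real s * ∫ x, f x ^ 2 ∂μ := by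
  have hfs : MemLp f 2 (μ.restrict s) := hf.restrict s
  have hint : Integrable f (μ.restrict s) := hfs.integrable one_le_two
  have hquad (t : ℝ) : 0 ≤ μ.real s * (t * t) + (-2 * ∫ x in s, f x ∂μ) * t
      + ∫ x in s, f x ^ 2 ∂μ := by
    calc 0 ≤ ∫ x in s, (f x - t) ^ 2 ∂μ := integral_nonneg fun _ => sq_nonneg _
      _ = ∫ x in s, (t * t + (-2 * t) * f x + f x ^ 2) ∂μ := by congr 1; ext x; ring
      _ = _ := by
        rw [integral_add (f := fun x => t * t + (-2 * t) * f x)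
          ((integrable_const _).add (hint.const_mul _)) hfs.integrable_sq,
          integral_add (integrable_const _) (hint.const_mul _), setIntegral_const,
          integral_const_mul, smul_eq_mul]
        ring
  have hdiscrim := discrim_le_zero hquad
  have hmono : μ.real s * ∫ x in s, f x ^ 2 ∂μ ≤ μ.real s * ∫ x, f x ^ 2 ∂μ :=
    mul_le_mul_of_nonneg_left (setIntegral_le_integral hf.integrable_sq
      (Filter.Eventually.of_forall fun _ => sq_nonneg _)) measureReal_nonneg
  rw [discrim] at hdiscrim
  linarith

lemma sq_le_mul_measureReal_half_le [IsProbabilityMeasure μ] (hf : MemLp f 2 μ) {m V : ℝ}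
    (hm : 0 ≤ m) (hmean : m ≤ ∫ x, f x ∂μ) (hvar : variance f μ ≤ V) :
    m ^ 2 ≤ 4 * (m ^ 2 + V) * μ.real {x | m / 2 ≤ f x} := by
  set A := {x | m / 2 ≤ f x}
  set a := ∫ x, f x ∂μ
  have hA : NullMeasurableSet A μ :=
    nullMeasurableSet_le aemeasurable_const hf.aestronglyMeasurable.aemeasurable
  have hint : Integrable f μ := hf.integrable one_le_two
  have hhalf : a / 2 ≤ ∫ x in A, f x ∂μ := by
    have hle : a ≤ ∫ x, (m / 2 + A.indicator f x) ∂μ := by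
      refine integral_mono hint ((integrable_const _).add (hint.indicator₀ hA)) fun x => ?_
      by_cases hx : x ∈ A
      · simpa only [Set.indicator_of_mem hx, le_add_iff_nonneg_left] using
          div_nonneg hm zero_le_two
      · simpa only [Set.indicator_of_notMem hx, add_zero] using (not_le.1 hx).le
    rw [integral_add (integrable_const _) (hint.indicator₀ hA), integral_indicator₀ hA,
      integral_const, probReal_univ, one_smul] at hle
    linarith
  have hsq : ∫ x, f x ^ 2 ∂μ ≤ a ^ 2 + V := by
    have hvar_eq := variance_eq_sub hf
    simp only [Pi.pow_apply] at hvar_eq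
    linarith
  have hPZ : (a / 2) ^ 2 ≤ μ.real A * (a ^ 2 + V) :=
    calc (a / 2) ^ 2 ≤ (∫ x in A, f x ∂μ) ^ 2 :=
          pow_le_pow_left₀ (div_nonneg (hm.trans hmean) zero_le_two) hhalf 2
      _ ≤ μ.real A * ∫ x, f x ^ 2 ∂μ := sq_setIntegral_le hf A
      _ ≤ μ.real A * (a ^ 2 + V) := mul_le_mul_of_nonneg_left hsq measureReal_nonneg
  have hV : 0 ≤ V := (variance_nonneg f μ).trans hvar
  have hma : m ^ 2 ≤ a ^ 2 := pow_le_pow_left₀ hm hmean 2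
  rcases le_total (1 / 4) (μ.real A) with hp | hp
  · nlinarith [sq_nonneg m]
  · nlinarith

end SecondMoment

section OddTilt

lemma one_add_nonneg_of_abs_le_one {a : ℝ} (ha : |a| ≤ 1) : 0 ≤ 1 + a := by
  linarith [neg_le_of_abs_le ha]

variable {G : Type*} [MeasurableSpace G]

/-- The law with density `1 + φ` relative to `μ`. It is meant for an odd `φ` with values in
`[-1, 1]` and a symmetric `μ`: the tilt then keeps the integrals of even functions, but moves the
mean by `∫ φ x * x`. -/
noncomputable def oddTilt (μ : Measure G) (φ : G → ℝ) : Measure G :=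
  μ.withDensity fun x => ENNReal.ofReal (1 + φ x)

variable {μ : Measure G} {φ f : G → ℝ}

lemma integral_oddTilt (hφm : Measurable φ) (hφ1 : ∀ x, |φ x| ≤ 1) (f : G → ℝ) :
    ∫ x, f x ∂oddTilt μ φ = ∫ x, (1 + φ x) * f x ∂μ := by
  rw [oddTilt, integral_withDensity_eq_integral_toReal_smul (by fun_prop) (by simp)]
  simp only [ENNReal.toReal_ofReal (one_add_nonneg_of_abs_le_one (hφ1 _)), smul_eq_mul]

lemma oddTilt_le (hφ1 : ∀ x, |φ x| ≤ 1) : oddTilt μ φ ≤ (2 : ENNReal) • μ := by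
  rw [oddTilt, ← withDensity_const]
  refine withDensity_mono (Filter.Eventually.of_forall fun x => ?_)
  rw [← ENNReal.ofReal_ofNat]
  exact ENNReal.ofReal_le_ofReal (by linarith [le_of_abs_le (hφ1 x)])

lemma integral_oddTilt_eq_add (hφm : Measurable φ) (hφ1 : ∀ x, |φ x| ≤ 1) (hf : Integrable f μ) :
    ∫ x, f x ∂oddTilt μ φ = ∫ x, f x ∂μ + ∫ x, φ x * f x ∂μ := by
  rw [integral_oddTilt hφm hφ1, ← integral_add hf
    (hf.bdd_mul hφm.aestronglyMeasurable (Filter.Eventually.of_forall hφ1))]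
  simp only [one_add_mul]

variable [AddGroup G] [MeasurableNeg G] [μ.IsNegInvariant]

lemma integral_eq_zero_of_odd (hf : f.Odd) : ∫ x, f x ∂μ = 0 := by
  have hneg : ∫ x, f (-x) ∂μ = ∫ x, f x ∂μ := integral_neg_eq_self f μ
  simp only [hf.eq, integral_neg] at hneg
  linarith

lemma integral_oddTilt_of_odd (hφm : Measurable φ) (hφ1 : ∀ x, |φ x| ≤ 1) (hf : Integrable f μ)
    (hodd : f.Odd) : ∫ x, f x ∂oddTilt μ φ = ∫ x, φ x * f x ∂μ := by
  rw [integral_oddTilt_eq_add hφm hφ1 hf, integral_eq_zero_of_odd hodd, zero_add]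

lemma integral_oddTilt_of_even (hφm : Measurable φ) (hφ : φ.Odd) (hφ1 : ∀ x, |φ x| ≤ 1)
    (hf : Integrable f μ) (heven : f.Even) : ∫ x, f x ∂oddTilt μ φ = ∫ x, f x ∂μ := by
  rw [integral_oddTilt_eq_add hφm hφ1 hf,
    integral_eq_zero_of_odd (f := fun x => φ x * f x) (hφ.mul_even heven), add_zero]

lemma isProbabilityMeasure_oddTilt [IsProbabilityMeasure μ] (hφm : Measurable φ) (hφ : φ.Odd)
    (hφ1 : ∀ x, |φ x| ≤ 1) : IsProbabilityMeasure (oddTilt μ φ) := by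
  rw [isProbabilityMeasure_iff_real]
  simpa using integral_oddTilt_of_even hφm hφ hφ1 (integrable_const (μ := μ) (1 : ℝ)) (.const 1)

lemma integral_one_add_sq_le [IsProbabilityMeasure μ] (hφm : Measurable φ) (hφ : φ.Odd)
    {c : ℝ} (hφc : ∀ x, |φ x| ≤ c) : ∫ x, (1 + φ x) ^ 2 ∂μ ≤ Real.exp (c ^ 2) := by
  have hφ_mem : MemLp φ 2 μ :=
    .of_bound hφm.aestronglyMeasurable c (Filter.Eventually.of_forall hφc)
  have hint : Integrable φ μ := hφ_mem.integrable one_le_two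
  have hint_sq : Integrable (fun x => 1 + φ x ^ 2) μ :=
    (integrable_const 1).add hφ_mem.integrable_sq
  calc ∫ x, (1 + φ x) ^ 2 ∂μ = ∫ x, (1 + φ x ^ 2 + 2 * φ x) ∂μ := by congr 1; ext x; ring
    _ = ∫ x, (1 + φ x ^ 2) ∂μ := by
      rw [integral_add hint_sq (hint.const_mul _), integral_const_mul,
        integral_eq_zero_of_odd hφ, mul_zero, add_zero]
    _ ≤ ∫ _, (1 + c ^ 2) ∂μ := by
      refine integral_mono hint_sq (integrable_const _) fun x => ?_
      exact add_le_add_right (sq_le_sq' (neg_le_of_abs_le (hφc x)) (le_of_abs_le (hφc x))) 1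
    _ ≤ Real.exp (c ^ 2) := by
      rw [integral_const, probReal_univ, one_smul, add_comm]
      exact Real.add_one_le_exp _

end OddTilt

section ProductMeasure

lemma sq_measureReal_withDensity_le {Ω : Type*} [MeasurableSpace Ω] {μ : Measure Ω}
    [IsFiniteMeasure μ] {D : Ω → ℝ} (hD : MemLp D 2 μ) (hD0 : 0 ≤ D) (s : Set Ω) :
    (μ.withDensity fun x => ENNReal.ofReal (D x)).real s ^ 2 ≤ μ.real s * ∫ x, D x ^ 2 ∂μ := by
  have hreal : (μ.withDensity fun x => ENNReal.ofReal (D x)).real s = ∫ x in s, D x ∂μ := by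
    rw [measureReal_def, withDensity_apply' _ s, integral_eq_lintegral_of_nonneg_ae
      (Filter.Eventually.of_forall hD0) hD.aestronglyMeasurable.restrict]
  rw [hreal]
  exact sq_setIntegral_le hD s

variable {ι : Type*} [Fintype ι]

lemma pi_withDensity {Ω : ι → Type*} [∀ i, MeasurableSpace (Ω i)] {μ : ∀ i, Measure (Ω i)}
    [∀ i, IsProbabilityMeasure (μ i)] {g : ∀ i, Ω i → ENNReal} (hg : ∀ i, Measurable (g i))
    [∀ i, SigmaFinite ((μ i).withDensity (g i))] :
    Measure.pi (fun i => (μ i).withDensity (g i))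
      = (Measure.pi μ).withDensity fun x => ∏ i, g i (x i) := by
  refine Measure.pi_eq fun s hs => ?_
  have hmeas (i : ι) : Measurable ((s i).indicator (g i)) := (hg i).indicator (hs i)
  have hprod (x : ∀ i, Ω i) : (Set.univ.pi s).indicator (fun x => ∏ i, g i (x i)) x
      = ∏ i, (s i).indicator (g i) (x i) := by
    by_cases hx : x ∈ Set.univ.pi s
    · rw [Set.indicator_of_mem hx]
      exact Finset.prod_congr rfl fun i _ =>
        (Set.indicator_of_mem (hx i (Set.mem_univ i)) (g i)).symm
    · obtain ⟨i, -, hi⟩ : ∃ i, i ∈ Set.univ ∧ x i ∉ s i := by simpa [Set.mem_pi] using hx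
      rw [Set.indicator_of_notMem hx]
      exact (Finset.prod_eq_zero (Finset.mem_univ i) (Set.indicator_of_notMem hi (g i))).symm
  calc (Measure.pi μ).withDensity (fun x => ∏ i, g i (x i)) (Set.univ.pi s)
      = ∫⁻ x, ∏ i, (s i).indicator (g i) (x i) ∂Measure.pi μ := by
        rw [withDensity_apply _ (MeasurableSet.univ_pi hs),
          ← lintegral_indicator (MeasurableSet.univ_pi hs)]
        simp only [hprod]
    _ = ∏ i, ∫⁻ x, (s i).indicator (g i) (x i) ∂Measure.pi μ :=
        lintegral_prod_eq_prod_lintegral_of_indepFun _ _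
          (iIndepFun_pi fun i => (hmeas i).aemeasurable)
          fun i => (hmeas i).comp (measurable_pi_apply i)
    _ = ∏ i, (μ i).withDensity (g i) (s i) := by
        refine Finset.prod_congr rfl fun i _ => ?_
        rw [withDensity_apply _ (hs i), ← lintegral_indicator (hs i)]
        exact (measurePreserving_eval μ i).lintegral_comp (hmeas i)

end ProductMeasure

section TiltedTail

variable {ι : Type*} [Fintype ι] {μ : ι → Measure ℝ} [∀ i, IsProbabilityMeasure (μ i)]
  [∀ i, (μ i).IsNegInvariant] {φ : ι → ℝ → ℝ} {c : ι → ℝ}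

lemma sq_measureReal_pi_oddTilt_le (hφm : ∀ i, Measurable (φ i)) (hφ : ∀ i, (φ i).Odd)
    (hφc : ∀ i x, |φ i x| ≤ c i) (hc : ∀ i, c i ≤ 1) (s : Set (ι → ℝ)) :
    (Measure.pi fun i => oddTilt (μ i) (φ i)).real s ^ 2
      ≤ (Measure.pi μ).real s * Real.exp (∑ i, c i ^ 2) := by
  have hφ1 (i : ι) (x : ℝ) : |φ i x| ≤ 1 := (hφc i x).trans (hc i)
  have (i : ι) : IsProbabilityMeasure ((μ i).withDensity fun x => ENNReal.ofReal (1 + φ i x)) :=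
    isProbabilityMeasure_oddTilt (hφm i) (hφ i) (hφ1 i)
  set D : (ι → ℝ) → ℝ := fun x => ∏ i, (1 + φ i (x i))
  have hD0 : 0 ≤ D := fun x =>
    Finset.prod_nonneg fun i _ => one_add_nonneg_of_abs_le_one (hφ1 i (x i))
  have hD : MemLp D 2 (Measure.pi μ) := by
    refine .of_bound (Measurable.aestronglyMeasurable (by fun_prop)) (∏ _i : ι, 2)
      (Filter.Eventually.of_forall fun x => ?_)
    rw [Real.norm_of_nonneg (hD0 x)]
    exact Finset.prod_le_prod (fun i _ => one_add_nonneg_of_abs_le_one (hφ1 i (x i)))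
      fun i _ => by linarith [le_of_abs_le (hφ1 i (x i))]
  have hpi : Measure.pi (fun i => oddTilt (μ i) (φ i))
      = (Measure.pi μ).withDensity fun x => ENNReal.ofReal (D x) := by
    simp only [oddTilt]
    rw [pi_withDensity fun i => by fun_prop]
    congr with x
    exact (ENNReal.ofReal_prod_of_nonneg fun i _ =>
      one_add_nonneg_of_abs_le_one (hφ1 i (x i))).symm
  rw [hpi]
  refine (sq_measureReal_withDensity_le hD hD0 s).trans
    (mul_le_mul_of_nonneg_left ?_ measureReal_nonneg)
  calc ∫ x, D x ^ 2 ∂Measure.pi μ = ∏ i, ∫ x, (1 + φ i x) ^ 2 ∂μ i := by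
        simp only [D, ← Finset.prod_pow]
        exact integral_fintype_prod_eq_prod fun i x => (1 + φ i x) ^ 2
    _ ≤ ∏ i, Real.exp (c i ^ 2) :=
        Finset.prod_le_prod (fun i _ => integral_nonneg fun _ => sq_nonneg _)
          fun i _ => integral_one_add_sq_le (hφm i) (hφ i) (hφc i)
    _ = Real.exp (∑ i, c i ^ 2) := (Real.exp_sum _ _).symm

variable {a : ι → ℝ} {m V : ℝ}

lemma sq_le_mul_measureReal_pi_oddTilt (hμ : ∀ i, MemLp id 2 (μ i))
    (hφm : ∀ i, Measurable (φ i)) (hφ : ∀ i, (φ i).Odd) (hφ1 : ∀ i x, |φ i x| ≤ 1)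
    (hm : 0 ≤ m) (hmean : m ≤ ∑ i, a i * ∫ x, φ i x * x ∂μ i)
    (hV : ∑ i, a i ^ 2 * ∫ x, x ^ 2 ∂μ i ≤ V) :
    m ^ 2 ≤ 4 * (m ^ 2 + V)
      * (Measure.pi fun i => oddTilt (μ i) (φ i)).real {x | m / 2 ≤ ∑ i, a i * x i} := by
  have (i : ι) : IsProbabilityMeasure (oddTilt (μ i) (φ i)) :=
    isProbabilityMeasure_oddTilt (hφm i) (hφ i) (hφ1 i)
  have hid (i : ι) : MemLp id 2 (oddTilt (μ i) (φ i)) :=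
    (hμ i).of_measure_le_smul (by simp) (oddTilt_le (hφ1 i))
  have hterm (i : ι) : MemLp (fun x => a i * x) 2 (oddTilt (μ i) (φ i)) := (hid i).const_mul (a i)
  have heval (i : ι) :
      MemLp (fun x : ι → ℝ => a i * x i) 2 (Measure.pi fun i => oddTilt (μ i) (φ i)) :=
    (hterm i).comp_measurePreserving (measurePreserving_eval _ i)
  refine sq_le_mul_measureReal_half_le (memLp_finsetSum _ fun i _ => heval i) hm ?_ ?_
  · rw [integral_finsetSum _ fun i _ => (heval i).integrable one_le_two]
    refine hmean.trans_eq (Finset.sum_congr rfl fun i _ => ?_)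
    rw [integral_const_mul, integral_comp_eval (μ := fun i => oddTilt (μ i) (φ i)) (i := i)
        (f := fun x : ℝ => x) (by fun_prop),
      integral_oddTilt_of_odd (f := fun x => x) (hφm i) (hφ1 i) ((hμ i).integrable one_le_two)
        fun _ => rfl]
  · have hsum : (fun x : ι → ℝ => ∑ i, a i * x i) = ∑ i, fun x : ι → ℝ => a i * x i := by
      ext x; simp
    rw [hsum, variance_sum_pi (X := fun i x => a i * x) hterm]
    refine (Finset.sum_le_sum fun i _ => ?_).trans hV
    rw [variance_const_mul, ← integral_oddTilt_of_even (f := fun x : ℝ => x ^ 2) (hφm i) (hφ i)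
      (hφ1 i) (hμ i).integrable_sq neg_sq]
    exact mul_le_mul_of_nonneg_left
      (variance_le_expectation_sq (hid i).aestronglyMeasurable) (sq_nonneg _)

lemma le_measureReal_pi_sum (hμ : ∀ i, MemLp id 2 (μ i)) (hφm : ∀ i, Measurable (φ i))
    (hφ : ∀ i, (φ i).Odd) (hφc : ∀ i x, |φ i x| ≤ c i) (hc : ∀ i, c i ≤ 1)
    (hm : 0 ≤ m) (hmean : m ≤ ∑ i, a i * ∫ x, φ i x * x ∂μ i)
    (hV : ∑ i, a i ^ 2 * ∫ x, x ^ 2 ∂μ i ≤ V) :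
    (m ^ 2 / (4 * (m ^ 2 + V))) ^ 2 * Real.exp (-∑ i, c i ^ 2)
      ≤ (Measure.pi μ).real {x | m / 2 ≤ ∑ i, a i * x i} := by
  set A : Set (ι → ℝ) := {x | m / 2 ≤ ∑ i, a i * x i}
  set q := (Measure.pi fun i => oddTilt (μ i) (φ i)).real A
  have hV0 : 0 ≤ V := (Finset.sum_nonneg fun i _ =>
    mul_nonneg (sq_nonneg (a i)) (integral_nonneg fun x => sq_nonneg x)).trans hV
  have hq : m ^ 2 / (4 * (m ^ 2 + V)) ≤ q :=
    div_le_of_le_mul₀ (by positivity) measureReal_nonneg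
      ((sq_le_mul_measureReal_pi_oddTilt hμ hφm hφ (fun i x => (hφc i x).trans (hc i))
        hm hmean hV).trans_eq (mul_comm _ _))
  calc (m ^ 2 / (4 * (m ^ 2 + V))) ^ 2 * Real.exp (-∑ i, c i ^ 2)
      ≤ q ^ 2 * Real.exp (-∑ i, c i ^ 2) := by gcongr
    _ ≤ (Measure.pi μ).real A * Real.exp (∑ i, c i ^ 2) * Real.exp (-∑ i, c i ^ 2) := by
        gcongr
        exact sq_measureReal_pi_oddTilt_le hφm hφ hφc hc A
    _ = (Measure.pi μ).real A := by rw [mul_assoc, ← Real.exp_add, add_neg_cancel,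
        Real.exp_zero, mul_one]

end TiltedTail

section TruncatedSign

/-- The sign of `x`, set to `0` where `|x| < κ`: the odd function along which a symmetric law with
a small-ball property at scale `κ` is tilted. -/
noncomputable def truncSign (κ x : ℝ) : ℝ := if κ ≤ |x| then x.sign else 0

lemma measurable_truncSign (κ : ℝ) : Measurable (truncSign κ) := by
  have hsign : Measurable Real.sign :=
    .ite measurableSet_Iio measurable_const
      (.ite measurableSet_Ioi measurable_const measurable_const)
  exact .ite (measurableSet_le measurable_const (by fun_prop)) hsign measurable_const

lemma odd_truncSign (κ : ℝ) : (truncSign κ).Odd := fun x => by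
  simp only [truncSign, abs_neg, Real.sign_neg, neg_ite, neg_zero]

lemma abs_truncSign_le_one (κ x : ℝ) : |truncSign κ x| ≤ 1 := by
  unfold truncSign
  split_ifs
  · obtain h | h | h := Real.sign_apply_eq x <;> simp [h]
  · simp

lemma indicator_le_truncSign_mul_self (κ x : ℝ) :
    {x : ℝ | κ ≤ |x|}.indicator (fun _ => κ) x ≤ truncSign κ x * x := by
  by_cases hx : κ ≤ |x|
  · have hsign : x.sign * x = |x| := by
      rcases lt_trichotomy x 0 with h | rfl | h
      · rw [Real.sign_of_neg h, abs_of_neg h, neg_one_mul]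
      · simp
      · rw [Real.sign_of_pos h, abs_of_pos h, one_mul]
    simp [truncSign, hx, hsign]
  · simp [truncSign, hx]

lemma mul_le_integral_truncSign_mul_self {μ : Measure ℝ} [IsFiniteMeasure μ] {κ δ : ℝ}
    (hκ : 0 ≤ κ) (hμ : Integrable id μ) (hδ : δ ≤ μ.real {x | κ ≤ |x|}) :
    κ * δ ≤ ∫ x, truncSign κ x * x ∂μ := by
  have hmeas : MeasurableSet {x : ℝ | κ ≤ |x|} := measurableSet_le measurable_const (by fun_prop)
  calc κ * δ ≤ ∫ x, {x : ℝ | κ ≤ |x|}.indicator (fun _ => κ) x ∂μ := by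
        rw [integral_indicator_const _ hmeas, smul_eq_mul, mul_comm]
        exact mul_le_mul_of_nonneg_right hδ hκ
    _ ≤ ∫ x, truncSign κ x * x ∂μ :=
        integral_mono ((integrable_const κ).indicator hmeas)
          (hμ.bdd_mul (measurable_truncSign κ).aestronglyMeasurable
            (Filter.Eventually.of_forall (abs_truncSign_le_one κ)))
          (indicator_le_truncSign_mul_self κ)

variable {ι : Type*} [Fintype ι] {μ : Measure ℝ} [IsProbabilityMeasure μ] [μ.IsNegInvariant]
  {κ δ : ℝ}

lemma le_measureReal_dotProduct (hμ : MemLp id 2 μ) (hμ1 : ∫ x, x ^ 2 ∂μ = 1) (hκ : 0 ≤ κ)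
    (hδ : δ ≤ μ.real {x | κ ≤ |x|}) {a c : ι → ℝ} (hc : ∀ i, |c i| ≤ 1) (hca : 0 ≤ c ⬝ᵥ a)
    {m V : ℝ} (hm : 0 ≤ m) (hmean : m ≤ κ * δ * (c ⬝ᵥ a)) (hV : a ⬝ᵥ a ≤ V) :
    (m ^ 2 / (4 * (m ^ 2 + V))) ^ 2 * Real.exp (-(c ⬝ᵥ c))
      ≤ (Measure.pi fun _ : ι => μ).real {x | m / 2 ≤ a ⬝ᵥ x} := by
  have hodd (i : ι) : (fun x => c i * truncSign κ x).Odd := fun x => by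
    simp only [(odd_truncSign κ).eq, mul_neg]
  have hbound (i : ι) (x : ℝ) : |c i * truncSign κ x| ≤ |c i| := by
    rw [abs_mul]
    exact mul_le_of_le_one_right (abs_nonneg _) (abs_truncSign_le_one κ x)
  have hmean' : m ≤ ∑ i, a i * ∫ x, c i * truncSign κ x * x ∂μ := by
    calc m ≤ (c ⬝ᵥ a) * ∫ x, truncSign κ x * x ∂μ := by
          rw [mul_comm] at hmean
          exact hmean.trans (mul_le_mul_of_nonneg_left
            (mul_le_integral_truncSign_mul_self hκ (hμ.integrable one_le_two) hδ) hca)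
      _ = _ := by
          rw [dotProduct, Finset.sum_mul]
          refine Finset.sum_congr rfl fun i _ => ?_
          simp only [mul_assoc, integral_const_mul]
          ring
  have hV' : ∑ i, a i ^ 2 * ∫ x, x ^ 2 ∂μ ≤ V := by
    simpa only [hμ1, mul_one, dotProduct, ← sq] using hV
  have hcc : c ⬝ᵥ c = ∑ i, |c i| ^ 2 := by simp only [dotProduct, sq_abs, ← sq]
  rw [hcc]
  exact le_measureReal_pi_sum (fun _ => hμ) (fun i => (measurable_truncSign κ).const_mul (c i))
    hodd hbound hc hm hmean' hV'

end TruncatedSign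

section Counting

variable {ι E : Type*}

lemma ncard_eq_sum_indicator [Fintype ι] (A : Set E) (x : ι → E) :
    ({i | x i ∈ A}.ncard : ℝ) = ∑ i, A.indicator 1 (x i) := by
  classical
  rw [Set.ncard_eq_toFinset_card']
  simp [Set.indicator_apply]

lemma exp_mul_indicator_one (A : Set E) (t : ℝ) (y : E) :
    Real.exp (t * A.indicator 1 y) = 1 + (Real.exp t - 1) * A.indicator 1 y := by
  by_cases h : y ∈ A <;> simp [h]

lemma exp_mul_ncard [Fintype ι] (A : Set E) (t : ℝ) (x : ι → E) :
    Real.exp (t * ({i | x i ∈ A}.ncard : ℝ)) = ∏ i, Real.exp (t * A.indicator 1 (x i)) := by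
  rw [ncard_eq_sum_indicator, Finset.mul_sum, Real.exp_sum]

variable [MeasurableSpace E] {A : Set E}

lemma measurable_ncard [Finite ι] (hA : MeasurableSet A) :
    Measurable fun x : ι → E => ({i | x i ∈ A}.ncard : ℝ) := by
  cases nonempty_fintype ι
  simp only [ncard_eq_sum_indicator]
  exact Finset.measurable_fun_sum _ fun i _ =>
    (measurable_one.indicator hA).comp (measurable_pi_apply i)

variable [Fintype ι] {ν : Measure E} [IsProbabilityMeasure ν]

lemma integrable_exp_mul_indicator_one (hA : MeasurableSet A) (t : ℝ) :
    Integrable (fun y => Real.exp (t * A.indicator 1 y)) ν := by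
  simp only [exp_mul_indicator_one]
  exact (integrable_const 1).add (((integrable_const 1).indicator hA).const_mul _)

lemma integral_exp_mul_indicator_one (hA : MeasurableSet A) (t : ℝ) :
    ∫ y, Real.exp (t * A.indicator 1 y) ∂ν = 1 + (Real.exp t - 1) * ν.real A := by
  simp only [exp_mul_indicator_one]
  rw [integral_add (integrable_const 1) (((integrable_const 1).indicator hA).const_mul _),
    integral_const_mul, integral_indicator_one hA, integral_const, probReal_univ, one_smul]

lemma integrable_exp_mul_ncard (hA : MeasurableSet A) (t : ℝ) :
    Integrable (fun x : ι → E => Real.exp (t * ({i | x i ∈ A}.ncard : ℝ)))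
      (Measure.pi fun _ => ν) := by
  simp only [exp_mul_ncard]
  exact Integrable.fintype_prod (μ := fun _ : ι => ν)
    fun _ => integrable_exp_mul_indicator_one hA t

lemma mgf_ncard_le (hA : MeasurableSet A) (t : ℝ) :
    mgf (fun x : ι → E => ({i | x i ∈ A}.ncard : ℝ)) (Measure.pi fun _ => ν) t
      ≤ Real.exp (Fintype.card ι * ((Real.exp t - 1) * ν.real A)) := by
  simp only [mgf, exp_mul_ncard]
  rw [integral_fintype_prod_eq_pow (ι := ι) (fun y => Real.exp (t * A.indicator 1 y)),
    Real.exp_nat_mul]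
  refine pow_le_pow_left₀ (integral_nonneg fun _ => (Real.exp_pos _).le) ?_ _
  rw [integral_exp_mul_indicator_one hA, add_comm]
  exact Real.add_one_le_exp _

lemma measureReal_ncard_le_le (hA : MeasurableSet A) {p : ℝ} (hp : p ≤ ν.real A) (s : ℝ) :
    (Measure.pi fun _ : ι => ν).real {x | ({i | x i ∈ A}.ncard : ℝ) ≤ s}
      ≤ Real.exp (s - 3 / 5 * (Fintype.card ι * p)) := by
  refine (measure_le_le_exp_mul_mgf (t := -1) s (by norm_num)
    (integrable_exp_mul_ncard hA _)).trans ?_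
  refine (mul_le_mul_of_nonneg_left (mgf_ncard_le hA _) (Real.exp_pos _).le).trans ?_
  rw [← Real.exp_add, Real.exp_le_exp]
  have hexp : Real.exp (-1) ≤ 2 / 5 := by
    rw [Real.exp_neg, inv_le_comm₀ (Real.exp_pos _) (by norm_num)]
    linarith [Real.exp_one_gt_d9]
  have hrate : 3 / 5 * p ≤ (1 - Real.exp (-1)) * ν.real A :=
    calc 3 / 5 * p ≤ 3 / 5 * ν.real A := by gcongr
      _ ≤ _ := mul_le_mul_of_nonneg_right (by linarith) measureReal_nonneg
  have := mul_le_mul_of_nonneg_left hrate (Nat.cast_nonneg (α := ℝ) (Fintype.card ι))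
  linarith

lemma measureReal_le_ncard_le (hA : MeasurableSet A) {q : ℝ} (hq : ν.real A ≤ q) (s : ℝ) :
    (Measure.pi fun _ : ι => ν).real {x | s ≤ ({i | x i ∈ A}.ncard : ℝ)}
      ≤ Real.exp (2 * (Fintype.card ι * q) - s) := by
  refine (measure_ge_le_exp_mul_mgf (t := 1) s zero_le_one
    (integrable_exp_mul_ncard hA _)).trans ?_
  refine (mul_le_mul_of_nonneg_left (mgf_ncard_le hA _) (Real.exp_pos _).le).trans ?_
  rw [← Real.exp_add, Real.exp_le_exp]
  have hrate : (Real.exp 1 - 1) * ν.real A ≤ 2 * q :=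
    calc _ ≤ 2 * ν.real A :=
          mul_le_mul_of_nonneg_right (by linarith [Real.exp_one_lt_d9]) measureReal_nonneg
      _ ≤ _ := by gcongr
  have := mul_le_mul_of_nonneg_left hrate (Nat.cast_nonneg (α := ℝ) (Fintype.card ι))
  linarith

lemma measureReal_biUnion_ncard_le_le {κ : Type*} {F : Finset κ} {A : κ → Set E}
    (hA : ∀ k, MeasurableSet (A k)) {p : ℝ} (hp : ∀ k ∈ F, p ≤ ν.real (A k)) :
    (Measure.pi fun _ : ι => ν).real
        (⋃ k ∈ F, {x | ({i | x i ∈ A k}.ncard : ℝ) ≤ Fintype.card ι * p / 2})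
      ≤ F.card * Real.exp (-(Fintype.card ι * p / 10)) := by
  refine (measureReal_biUnion_finset_le _ _).trans
    ((Finset.sum_le_card_nsmul F _ _ fun k hk => ?_).trans_eq (nsmul_eq_mul _ _))
  exact (measureReal_ncard_le_le (hA k) (hp k hk) _).trans_eq (by ring_nf)

lemma exists_measurableSet_forall_lt_ncard {κ : Type*} {𝒩 : Finset κ} {A : κ → Set E} {D : Set E}
    (hA : ∀ k, MeasurableSet (A k)) (hD : MeasurableSet D) {u : ℝ} (hu : 0 ≤ u)
    (hcard : (𝒩.card : ℝ) ≤ Real.exp (Fintype.card ι * u / 5)) (hDu : ν.real D ≤ u / 8) :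
    ∃ B : Set (ι → E), MeasurableSet B ∧
      (Measure.pi fun _ => ν).real B ≤ 2 * Real.exp (-(Fintype.card ι * u / 5)) ∧
      ∀ x ∉ B, ({i | x i ∈ D}.ncard : ℝ) < Fintype.card ι * u / 2 ∧
        ∀ k ∈ 𝒩, 4 * u ≤ ν.real (A k) →
          2 * (Fintype.card ι * u) < ({i | x i ∈ A k}.ncard : ℝ) := by
  classical
  set N := (Fintype.card ι : ℝ)
  set F := 𝒩.filter fun k => 4 * u ≤ ν.real (A k)
  let B₁ : Set (ι → E) := ⋃ k ∈ F, {x | ({i | x i ∈ A k}.ncard : ℝ) ≤ N * (4 * u) / 2}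
  let B₂ : Set (ι → E) := {x | N * u / 2 ≤ ({i | x i ∈ D}.ncard : ℝ)}
  have hB₁ : (Measure.pi fun _ => ν).real B₁ ≤ Real.exp (-(N * u / 5)) := by
    calc (Measure.pi fun _ => ν).real B₁ ≤ F.card * Real.exp (-(N * (4 * u) / 10)) :=
          measureReal_biUnion_ncard_le_le hA fun k hk => (Finset.mem_filter.1 hk).2
      _ ≤ Real.exp (N * u / 5) * Real.exp (-(N * (4 * u) / 10)) := by
          gcongr
          exact (Nat.cast_le.2 (Finset.card_filter_le _ _)).trans hcard
      _ = Real.exp (-(N * u / 5)) := by rw [← Real.exp_add]; ring_nf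
  have hB₂ : (Measure.pi fun _ => ν).real B₂ ≤ Real.exp (-(N * u / 5)) := by
    refine (measureReal_le_ncard_le hD hDu _).trans (Real.exp_le_exp.2 ?_)
    have : 0 ≤ N * u := by positivity
    linarith
  refine ⟨B₁ ∪ B₂, ?_, (measureReal_union_le _ _).trans (by linarith), fun x hx => ?_⟩
  · exact (Finset.measurableSet_biUnion _ fun k _ =>
      measurableSet_le (measurable_ncard (hA k)) measurable_const).union
      (measurableSet_le measurable_const (measurable_ncard hD))
  obtain ⟨hx₁, hx₂⟩ := not_or.1 hx
  refine ⟨not_le.1 hx₂, fun k hk hAk => ?_⟩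
  by_contra! hle
  exact hx₁ (Set.mem_biUnion (Finset.mem_filter.2 ⟨hk, hAk⟩) (hle.trans_eq (by ring)))

end Counting

section Net

lemma sum_exp_neg_mul_abs_le (s : Finset ℤ) {l : ℝ} (hl : 0 < l) :
    ∑ k ∈ s, Real.exp (-(l * |(k : ℝ)|)) ≤ 2 / (1 - Real.exp (-l)) := by
  have hlt : Real.exp (-l) < 1 := Real.exp_lt_one_iff.2 (neg_lt_zero.2 hl)
  have hgeom := hasSum_geometric_of_lt_one (Real.exp_pos (-l)).le hlt
  have hpow (k : ℕ) : Real.exp (-(l * k)) = Real.exp (-l) ^ k := by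
    rw [← Real.exp_nat_mul, mul_comm l, mul_neg]
  have hneg (k : ℕ) :
      Real.exp (-(l * |((-(k + 1) : ℤ) : ℝ)|)) = Real.exp (-l) * Real.exp (-l) ^ k := by
    rw [← pow_succ', ← hpow]
    push_cast
    rw [abs_neg, abs_of_nonneg (by positivity)]
  have hsum : HasSum (fun k : ℤ => Real.exp (-(l * |(k : ℝ)|)))
      ((1 - Real.exp (-l))⁻¹ + Real.exp (-l) * (1 - Real.exp (-l))⁻¹) := by
    refine .of_nat_of_neg_add_one ?_ ?_
    · simpa only [Int.cast_natCast, Nat.abs_cast, hpow] using hgeom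
    · simpa only [hneg] using hgeom.mul_left (Real.exp (-l))
  refine (sum_le_hasSum s (fun _ _ => (Real.exp_pos _).le) hsum).trans ?_
  rw [← one_add_mul, ← div_eq_mul_inv]
  have : 0 < 1 - Real.exp (-l) := sub_pos.2 hlt
  gcongr
  linarith

variable {ι : Type*} [Fintype ι]

lemma finite_setOf_sum_abs_le (M : ℝ) : {k : ι → ℤ | ∑ j, |(k j : ℝ)| ≤ M}.Finite := by
  classical
  refine (Set.finite_Icc (fun _ => -⌊M⌋) (fun _ => ⌊M⌋)).subset fun k hk => ?_
  have hle (j : ι) : |k j| ≤ ⌊M⌋ := by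
    refine Int.le_floor.2 ((Int.cast_abs (R := ℝ)).trans_le (le_trans ?_ hk))
    exact Finset.single_le_sum (f := fun j => |(k j : ℝ)|) (fun _ _ => abs_nonneg _)
      (Finset.mem_univ j)
  exact ⟨fun j => neg_le_of_abs_le (hle j), fun j => le_of_abs_le (hle j)⟩

lemma card_le_of_sum_abs_le {F : Finset (ι → ℤ)} {M l : ℝ} (hl : 0 < l)
    (hF : ∀ k ∈ F, ∑ j, |(k j : ℝ)| ≤ M) :
    (F.card : ℝ) ≤ Real.exp (l * M) * (2 / (1 - Real.exp (-l))) ^ Fintype.card ι := by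
  classical
  let B (j : ι) : Finset ℤ := F.image fun k => k j
  have hsub : F ⊆ Fintype.piFinset B := fun k hk =>
    Fintype.mem_piFinset.2 fun j => Finset.mem_image_of_mem _ hk
  have hterm (k : ι → ℤ) (hk : k ∈ F) :
      1 ≤ Real.exp (l * M) * ∏ j, Real.exp (-(l * |(k j : ℝ)|)) := by
    rw [← Real.exp_sum, Finset.sum_neg_distrib, ← Finset.mul_sum, ← Real.exp_add]
    exact Real.one_le_exp (by linarith [mul_le_mul_of_nonneg_left (hF k hk) hl.le])
  calc (F.card : ℝ) ≤ ∑ k ∈ F, Real.exp (l * M) * ∏ j, Real.exp (-(l * |(k j : ℝ)|)) := by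
        simpa only [nsmul_eq_mul, mul_one] using Finset.card_nsmul_le_sum F _ 1 hterm
    _ ≤ ∑ k ∈ Fintype.piFinset B, Real.exp (l * M) * ∏ j, Real.exp (-(l * |(k j : ℝ)|)) :=
        Finset.sum_le_sum_of_subset_of_nonneg hsub fun _ _ _ => by positivity
    _ = Real.exp (l * M) * ∏ j, ∑ b ∈ B j, Real.exp (-(l * |(b : ℝ)|)) := by
        rw [← Finset.mul_sum, Finset.prod_univ_sum]
    _ ≤ Real.exp (l * M) * (2 / (1 - Real.exp (-l))) ^ Fintype.card ι := by
        gcongr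
        exact (Finset.prod_le_prod (fun j _ => Finset.sum_nonneg fun _ _ => (Real.exp_pos _).le)
          fun j _ => sum_exp_neg_mul_abs_le _ hl).trans_eq (Finset.prod_const _)

lemma card_le_of_sum_abs_le_mul_card {F : Finset (ι → ℤ)} {t : ℝ} (ht : 0 < t)
    (hF : ∀ k ∈ F, ∑ j, |(k j : ℝ)| ≤ t * Fintype.card ι) :
    (F.card : ℝ) ≤ (2 * Real.exp 1 * (1 + t)) ^ Fintype.card ι := by
  have hexp : Real.exp (-t⁻¹) ≤ 1 - (1 + t)⁻¹ := by
    calc Real.exp (-t⁻¹) ≤ (t⁻¹ + 1)⁻¹ := by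
          rw [Real.exp_neg]
          exact inv_anti₀ (by positivity) (Real.add_one_le_exp _)
      _ = 1 - (1 + t)⁻¹ := by field_simp; ring
  calc (F.card : ℝ)
      ≤ Real.exp (t⁻¹ * (t * Fintype.card ι)) * (2 / (1 - Real.exp (-t⁻¹))) ^ Fintype.card ι :=
        card_le_of_sum_abs_le (inv_pos.2 ht) hF
    _ ≤ Real.exp 1 ^ Fintype.card ι * (2 / (1 + t)⁻¹) ^ Fintype.card ι := by
        rw [inv_mul_cancel_left₀ ht.ne', ← Real.exp_nat_mul, mul_one]
        have : 0 < (1 + t)⁻¹ := by positivity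
        gcongr
        · exact div_nonneg zero_le_two (by linarith)
        · linarith
    _ = (2 * Real.exp 1 * (1 + t)) ^ Fintype.card ι := by rw [← mul_pow, div_inv_eq_mul]; ring

lemma exists_int_abs_sub_le_mul_nonpos (z c : ℝ) {h : ℝ} (hh : 0 < h) :
    ∃ k : ℤ, |z - h * k| ≤ h ∧ (z - h * k) * c ≤ 0 := by
  rcases le_total 0 c with hc | hc
  · have hle := (div_le_iff₀' hh).1 (Int.le_ceil (z / h))
    have hlt := (lt_div_iff₀' hh).1 (sub_lt_iff_lt_add.2 (Int.ceil_lt_add_one (z / h)))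
    exact ⟨⌈z / h⌉, abs_le.2 ⟨by linarith, by linarith⟩,
      mul_nonpos_of_nonpos_of_nonneg (by linarith) hc⟩
  · have hle := (le_div_iff₀' hh).1 (Int.floor_le (z / h))
    have hlt := (div_lt_iff₀' hh).1 (Int.lt_floor_add_one (z / h))
    exact ⟨⌊z / h⌋, abs_le.2 ⟨by linarith, by linarith⟩,
      mul_nonpos_of_nonneg_of_nonpos (by linarith) hc⟩

lemma exists_int_norm_sq_sum_sub_smul_le {E : Type*} [NormedAddCommGroup E]
    [InnerProductSpace ℝ E] (X : ι → E) (z : ι → ℝ) {h : ℝ} (hh : 0 < h) :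
    ∃ k : ι → ℤ, (∀ j, |z j - h * k j| ≤ h) ∧
      ‖∑ j, (z j - h * k j) • X j‖ ^ 2 ≤ h ^ 2 * ∑ j, ‖X j‖ ^ 2 := by
  classical
  suffices H : ∀ s : Finset ι, ∃ k : ι → ℤ, (∀ j ∈ s, |z j - h * k j| ≤ h) ∧
      ‖∑ j ∈ s, (z j - h * k j) • X j‖ ^ 2 ≤ h ^ 2 * ∑ j ∈ s, ‖X j‖ ^ 2 by
    simpa only [Finset.mem_univ, true_imp_iff] using H Finset.univ
  intro s
  induction s using Finset.induction_on with
  | empty => exact ⟨0, by simp⟩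
  | insert a s ha ih =>
    obtain ⟨k, hk, hs⟩ := ih
    set T := ∑ j ∈ s, (z j - h * k j) • X j
    -- The sign of the last rounding error is chosen against the error accumulated so far.
    obtain ⟨b, hb, hinner⟩ := exists_int_abs_sub_le_mul_nonpos (z a) (inner ℝ (X a) T) hh
    have hne (j : ι) (hj : j ∈ s) : Function.update k a b j = k j :=
      Function.update_of_ne (ne_of_mem_of_not_mem hj ha) b k
    refine ⟨Function.update k a b, Finset.forall_mem_insert .. |>.2 ⟨?_, fun j hj => ?_⟩, ?_⟩
    · rwa [Function.update_self]
    · rw [hne j hj]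
      exact hk j hj
    · rw [Finset.sum_insert ha, Finset.sum_insert ha, Function.update_self,
        Finset.sum_congr rfl fun j hj => by rw [hne j hj], norm_add_sq_real, norm_smul,
        real_inner_smul_left, mul_pow, Real.norm_eq_abs]
      have := mul_le_mul_of_nonneg_right (pow_le_pow_left₀ (abs_nonneg _) hb 2)
        (sq_nonneg ‖X a‖)
      linarith

variable {ι' : Type*}

lemma exists_int_sum_sq_dotProduct_le (S : Finset ι') (Γ : ι' → ι → ℝ) (z : ι → ℝ) {h : ℝ}
    (hh : 0 < h) :
    ∃ k : ι → ℤ, (∀ j, |z j - h * k j| ≤ h) ∧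
      ∑ i ∈ S, ((z - fun j => h * k j) ⬝ᵥ Γ i) ^ 2 ≤ h ^ 2 * ∑ i ∈ S, Γ i ⬝ᵥ Γ i := by
  obtain ⟨k, hk, hnorm⟩ := exists_int_norm_sq_sum_sub_smul_le
    (fun j => (WithLp.toLp 2 fun i : S => Γ i j : EuclideanSpace ℝ S)) z hh
  refine ⟨k, hk, ?_⟩
  simp only [EuclideanSpace.real_norm_sq_eq, WithLp.ofLp_sum, WithLp.ofLp_smul, Finset.sum_apply,
    Pi.smul_apply, smul_eq_mul] at hnorm
  rw [Finset.sum_comm, Finset.sum_coe_sort S fun i => (∑ j, (z j - h * k j) * Γ i j) ^ 2,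
    Finset.sum_coe_sort S fun i => ∑ j, Γ i j ^ 2] at hnorm
  simpa only [dotProduct, Pi.sub_apply, ← sq] using hnorm

lemma sum_abs_le_of_abs_sub_le [Nonempty ι] {z : ι → ℝ} (hz : z ⬝ᵥ z ≤ 1) {r : ℝ} (hr : 0 < r)
    {k : ι → ℤ} (hk : ∀ j, |z j - r / √(Fintype.card ι) * k j| ≤ r / √(Fintype.card ι)) :
    ∑ j, |(k j : ℝ)| ≤ (1 + 1 / r) * Fintype.card ι := by
  set n := (Fintype.card ι : ℝ)
  have hn : 0 < n := Nat.cast_pos.2 Fintype.card_pos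
  have hsqrt : √n * √n = n := Real.mul_self_sqrt hn.le
  have hz_abs : ∑ j, |z j| ≤ √n := by
    refine Real.le_sqrt_of_sq_le ((sq_sum_le_card_mul_sum_sq (s := Finset.univ)).trans ?_)
    simpa only [sq_abs, Finset.card_univ, dotProduct, ← sq, mul_one] using
      mul_le_mul_of_nonneg_left hz hn.le
  have hterm (j : ι) : r / √n * |(k j : ℝ)| ≤ |z j| + r / √n := by
    have := abs_sub_abs_le_abs_sub (r / √n * k j) (z j)
    rw [abs_sub_comm, abs_mul, abs_of_pos (by positivity)] at this
    linarith [hk j]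
  have hsum : r / √n * ∑ j, |(k j : ℝ)| ≤ √n + n * (r / √n) := by
    rw [Finset.mul_sum]
    refine (Finset.sum_le_sum fun j _ => hterm j).trans ?_
    rw [Finset.sum_add_distrib, Finset.sum_const, Finset.card_univ, nsmul_eq_mul]
    gcongr
  rw [← le_div_iff₀' (by positivity)] at hsum
  refine hsum.trans_eq ?_
  field_simp
  nlinarith

lemma exists_finset_rounding (ι ι' : Type*) [Fintype ι] [Nonempty ι] {r : ℝ} (hr : 0 < r)
    (hr1 : r ≤ 1) :
    ∃ 𝒩 : Finset (ι → ℝ), (𝒩.card : ℝ) ≤ (6 * Real.exp 1 / r) ^ Fintype.card ι ∧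
      ∀ z : ι → ℝ, z ⬝ᵥ z ≤ 1 → ∀ (S : Finset ι') (Γ : ι' → ι → ℝ), ∃ y ∈ 𝒩,
        (z - y) ⬝ᵥ (z - y) ≤ r ^ 2 ∧
        Fintype.card ι * ∑ i ∈ S, ((z - y) ⬝ᵥ Γ i) ^ 2 ≤ r ^ 2 * ∑ i ∈ S, Γ i ⬝ᵥ Γ i := by
  classical
  set n := (Fintype.card ι : ℝ)
  have hn : 0 < n := Nat.cast_pos.2 Fintype.card_pos
  set h := r / √n
  have hnh : n * h ^ 2 = r ^ 2 := by
    rw [div_pow, Real.sq_sqrt hn.le, mul_div_cancel₀ _ hn.ne']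
  have hfin := finite_setOf_sum_abs_le (ι := ι) ((1 + 1 / r) * n)
  refine ⟨hfin.toFinset.image fun k j => h * k j, ?_, fun z hz S Γ => ?_⟩
  · calc ((hfin.toFinset.image fun k j => h * (k j : ℝ)).card : ℝ) ≤ hfin.toFinset.card := by
          exact_mod_cast Finset.card_image_le
      _ ≤ (2 * Real.exp 1 * (1 + (1 + 1 / r))) ^ Fintype.card ι :=
          card_le_of_sum_abs_le_mul_card (by positivity) fun k hk => hfin.mem_toFinset.1 hk
      _ ≤ (6 * Real.exp 1 / r) ^ Fintype.card ι := by
          have : 1 + (1 + 1 / r) ≤ 3 / r := by rw [le_div_iff₀ hr]; field_simp; linarith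
          gcongr
          calc 2 * Real.exp 1 * (1 + (1 + 1 / r)) ≤ 2 * Real.exp 1 * (3 / r) := by gcongr
            _ = 6 * Real.exp 1 / r := by ring
  · obtain ⟨k, hk, hsum⟩ := exists_int_sum_sq_dotProduct_le S Γ z (h := h) (by positivity)
    refine ⟨fun j => h * k j, Finset.mem_image_of_mem _ (hfin.mem_toFinset.2
      (sum_abs_le_of_abs_sub_le hz hr hk)), ?_, ?_⟩
    · calc (z - fun j => h * k j) ⬝ᵥ (z - fun j => h * k j) ≤ ∑ _j : ι, h ^ 2 :=
            Finset.sum_le_sum fun j _ => by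
              rw [Pi.sub_apply, ← sq]
              exact sq_le_sq' (neg_le_of_abs_le (hk j)) (le_of_abs_le (hk j))
        _ = r ^ 2 := by rw [Finset.sum_const, Finset.card_univ, nsmul_eq_mul, hnh]
    · rw [← hnh, mul_assoc]
      exact mul_le_mul_of_nonneg_left hsum hn.le

end Net

section Uniform

variable {ι ι' : Type*}

lemma ncard_two_mul_le_abs_le [Finite ι'] (f g : ι' → ℝ) (S : Finset ι') {c : ℝ} (hc : 0 < c) :
    ({i | 2 * c ≤ |f i|}.ncard : ℝ)
      ≤ {i | c ≤ |g i|}.ncard + {i | i ∉ S}.ncard + (∑ i ∈ S, (g i - f i) ^ 2) / c ^ 2 := by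
  set R := S.filter fun i => c ≤ |g i - f i|
  have hsub : {i | 2 * c ≤ |f i|} ⊆ {i | c ≤ |g i|} ∪ {i | i ∉ S} ∪ R := by
    intro i hi
    by_contra hnot
    simp only [R, Set.mem_union, Set.mem_ofPred_eq, Finset.mem_coe, Finset.mem_filter, not_or,
      not_and, not_not, not_le] at hnot hi
    obtain ⟨⟨hg, hS⟩, hR⟩ := hnot
    have := abs_sub_abs_le_abs_sub (f i) (g i)
    rw [abs_sub_comm] at this
    linarith [hR hS]
  have hunion : ({i | 2 * c ≤ |f i|}.ncard : ℝ)
      ≤ {i | c ≤ |g i|}.ncard + {i | i ∉ S}.ncard + R.card := by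
    rw [← Set.ncard_coe_finset R]
    exact_mod_cast (Set.ncard_le_ncard hsub (Set.toFinite _)).trans
      ((Set.ncard_union_le _ _).trans (Nat.add_le_add_right (Set.ncard_union_le _ _) _))
  have hR : R.card * c ^ 2 ≤ ∑ i ∈ S, (g i - f i) ^ 2 := by
    calc R.card * c ^ 2 = ∑ _i ∈ R, c ^ 2 := by rw [Finset.sum_const, nsmul_eq_mul]
      _ ≤ ∑ i ∈ R, (g i - f i) ^ 2 := Finset.sum_le_sum fun i hi => by
        rw [← sq_abs (g i - f i)]
        exact pow_le_pow_left₀ hc.le (Finset.mem_filter.1 hi).2 2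
      _ ≤ ∑ i ∈ S, (g i - f i) ^ 2 :=
        Finset.sum_le_sum_of_subset_of_nonneg (Finset.filter_subset _ _) fun _ _ _ => sq_nonneg _
  rw [← le_div_iff₀ (by positivity)] at hR
  linarith

variable [Fintype ι] [Fintype ι']

lemma exists_finset_ncard_le [Nonempty ι] {c u : ℝ} (hc : 0 < c) (hu : 0 < u)
    (hcu : c * u / 4 ≤ 1) :
    ∃ 𝒩 : Finset (ι → ℝ), (𝒩.card : ℝ) ≤ (6 * Real.exp 1 / (c * u / 4)) ^ Fintype.card ι ∧
      ∀ z : ι → ℝ, z ⬝ᵥ z ≤ 1 → ∀ Γ : ι' → ι → ℝ, ∃ y ∈ 𝒩,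
        (z - y) ⬝ᵥ (z - y) ≤ (c * u / 4) ^ 2 ∧
        ({i | 2 * c ≤ |y ⬝ᵥ Γ i|}.ncard : ℝ) ≤ {i | c ≤ |z ⬝ᵥ Γ i|}.ncard
          + {i | 8 / u * Fintype.card ι ≤ Γ i ⬝ᵥ Γ i}.ncard + Fintype.card ι' * u / 2 := by
  classical
  obtain ⟨𝒩, hcard, hround⟩ := exists_finset_rounding ι ι' (r := c * u / 4) (by positivity) hcu
  refine ⟨𝒩, hcard, fun z hz Γ => ?_⟩
  set n := (Fintype.card ι : ℝ)
  have hn : 0 < n := Nat.cast_pos.2 Fintype.card_pos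
  set S := Finset.univ.filter fun i => Γ i ⬝ᵥ Γ i < 8 / u * n
  obtain ⟨y, hy, hdist, hsum⟩ := hround z hz S Γ
  refine ⟨y, hy, hdist, ?_⟩
  have hshort : ∑ i ∈ S, Γ i ⬝ᵥ Γ i ≤ Fintype.card ι' * (8 / u * n) := by
    calc ∑ i ∈ S, Γ i ⬝ᵥ Γ i ≤ S.card * (8 / u * n) :=
          (Finset.sum_le_card_nsmul _ _ _ fun i hi => (Finset.mem_filter.1 hi).2.le).trans_eq
            (nsmul_eq_mul _ _)
      _ ≤ Fintype.card ι' * (8 / u * n) := by gcongr; exact Finset.card_le_univ S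
  have herror : (∑ i ∈ S, (z ⬝ᵥ Γ i - y ⬝ᵥ Γ i) ^ 2) / c ^ 2 ≤ Fintype.card ι' * u / 2 := by
    simp only [← sub_dotProduct]
    rw [div_le_iff₀ (by positivity), ← mul_le_mul_iff_right₀ hn]
    refine hsum.trans ((mul_le_mul_of_nonneg_left hshort (sq_nonneg _)).trans_eq ?_)
    field_simp
    ring
  have hlong : {i | i ∉ S} = {i | 8 / u * n ≤ Γ i ⬝ᵥ Γ i} := by
    ext i
    simp only [S, Set.mem_ofPred_eq, Finset.mem_filter, Finset.mem_univ, true_and, not_lt]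
  have := ncard_two_mul_le_abs_le (fun i => y ⬝ᵥ Γ i) (fun i => z ⬝ᵥ Γ i) S hc
  rw [hlong] at this
  linarith

lemma dotProduct_self_le_four {z y : ι → ℝ} (hz : z ⬝ᵥ z ≤ 1)
    (hzy : (z - y) ⬝ᵥ (z - y) ≤ 1) : y ⬝ᵥ y ≤ 4 := by
  have hparallelogram : y ⬝ᵥ y + (2 • z - y) ⬝ᵥ (2 • z - y)
      = 2 * (z ⬝ᵥ z) + 2 * ((z - y) ⬝ᵥ (z - y)) := by
    simp only [sub_dotProduct, dotProduct_sub, smul_dotProduct, dotProduct_smul,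
      dotProduct_comm y z]
    ring
  have : 0 ≤ (2 • z - y) ⬝ᵥ (2 • z - y) :=
    Finset.sum_nonneg fun j _ => mul_self_nonneg _
  linarith

lemma sub_le_dotProduct {v z y : ι → ℝ} {ε : ℝ} (hε : 0 ≤ ε)
    (h : (v ⬝ᵥ v) * ((z - y) ⬝ᵥ (z - y)) ≤ ε ^ 2) : v ⬝ᵥ z - ε ≤ v ⬝ᵥ y := by
  have hcs : (v ⬝ᵥ (z - y)) ^ 2 ≤ (v ⬝ᵥ v) * ((z - y) ⬝ᵥ (z - y)) := by
    simpa only [dotProduct, ← sq] using Finset.sum_mul_sq_le_sq_mul_sq Finset.univ v (z - y)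
  have := (abs_le_of_sq_le_sq' (hcs.trans h) hε).2
  rw [dotProduct_sub] at this
  linarith

lemma exists_measurableSet_forall_mul_le_ncard [Nonempty ι] {ν : Measure (ι → ℝ)}
    [IsProbabilityMeasure ν] {u c T : ℝ} (hu : 0 < u) (hc : 0 < c) (hcu : c * u / 4 ≤ 1)
    (hT : T * (c * u / 4) ^ 2 ≤ 1 / 16)
    (hnet : Fintype.card ι * (1 + Real.log (6 / (c * u / 4))) ≤ Fintype.card ι' * u / 5)
    (hlong : ν.real {x | 8 / u * Fintype.card ι ≤ x ⬝ᵥ x} ≤ u / 8)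
    {K : Set (ι → ℝ)} (hK : ∀ v ∈ K, v ⬝ᵥ v ≤ T)
    (htail : ∀ y : ι → ℝ, y ⬝ᵥ y ≤ 4 → (∃ v ∈ K, 1 / 4 ≤ v ⬝ᵥ y) →
      4 * u ≤ ν.real {x | 2 * c ≤ |y ⬝ᵥ x|}) :
    ∃ B : Set (ι' → ι → ℝ), MeasurableSet B ∧
      (Measure.pi fun _ => ν).real B ≤ 2 * Real.exp (-(Fintype.card ι' * u / 5)) ∧
      ∀ Γ ∉ B, ∀ z : ι → ℝ, z ⬝ᵥ z ≤ 1 → (∃ v ∈ K, 1 / 2 ≤ v ⬝ᵥ z) →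
        Fintype.card ι' * u ≤ ({i | c ≤ |z ⬝ᵥ Γ i|}.ncard : ℝ) := by
  set r := c * u / 4
  have hr : 0 < r := by positivity
  obtain ⟨𝒩, hcard, happrox⟩ := exists_finset_ncard_le (ι := ι) (ι' := ι') hc hu hcu
  have hcard' : (𝒩.card : ℝ) ≤ Real.exp (Fintype.card ι' * u / 5) := by
    calc (𝒩.card : ℝ) ≤ (6 * Real.exp 1 / r) ^ Fintype.card ι := hcard
      _ = Real.exp (Fintype.card ι * (1 + Real.log (6 / r))) := by
          rw [Real.exp_nat_mul, Real.exp_add, Real.exp_log (by positivity)]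
          ring_nf
      _ ≤ Real.exp (Fintype.card ι' * u / 5) := Real.exp_le_exp.2 hnet
  have htail_meas (y : ι → ℝ) : MeasurableSet {x | 2 * c ≤ |y ⬝ᵥ x|} :=
    measurableSet_le measurable_const (by fun_prop)
  obtain ⟨B, hB, hBν, hgood⟩ := exists_measurableSet_forall_lt_ncard (ι := ι') htail_meas
    (measurableSet_le measurable_const (by fun_prop)) hu.le hcard' hlong
  refine ⟨B, hB, hBν, ?_⟩
  rintro Γ hΓ z hz ⟨v, hvK, hvz⟩
  obtain ⟨hlong_count, htail_count⟩ := hgood Γ hΓ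
  obtain ⟨y, hy, hzy, hcount⟩ := happrox z hz Γ
  have hy4 : y ⬝ᵥ y ≤ 4 := dotProduct_self_le_four hz (hzy.trans (pow_le_one₀ hr.le hcu))
  have hvy : 1 / 4 ≤ v ⬝ᵥ y := by
    have hprod : (v ⬝ᵥ v) * ((z - y) ⬝ᵥ (z - y)) ≤ (1 / 4) ^ 2 := by
      calc (v ⬝ᵥ v) * ((z - y) ⬝ᵥ (z - y)) ≤ (v ⬝ᵥ v) * r ^ 2 :=
            mul_le_mul_of_nonneg_left hzy (Finset.sum_nonneg fun j _ => mul_self_nonneg _)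
        _ ≤ T * r ^ 2 := mul_le_mul_of_nonneg_right (hK v hvK) (sq_nonneg r)
        _ ≤ (1 / 4) ^ 2 := by linarith
    linarith [sub_le_dotProduct (by norm_num) hprod]
  have := htail_count y hy (htail y hy4 ⟨v, hvK, hvy⟩)
  simp only [Set.mem_ofPred_eq] at this hlong_count
  linarith

end Uniform

section Polar

variable {E : Type*} [NormedAddCommGroup E] [InnerProductSpace ℝ E] {K : Set E} {z : E}

lemma norm_le_one_of_mem_frontier_polar (hK : Metric.closedBall 0 1 ⊆ K)
    (hz : z ∈ frontier ((innerₗ E).polar K)) : ‖z‖ ≤ 1 := by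
  have hsub : (innerₗ E).polar K ⊆ Metric.closedBall 0 1 := fun y hy => by
    rcases eq_or_ne y 0 with rfl | hy0
    · simp
    have hunit : ‖‖y‖⁻¹ • y‖ = 1 := norm_smul_inv_norm (𝕜 := ℝ) hy0
    have h : |inner ℝ (‖y‖⁻¹ • y) y| ≤ 1 := hy _ (hK (mem_closedBall_zero_iff.2 hunit.le))
    rw [real_inner_smul_left, real_inner_self_eq_norm_sq, sq, ← mul_assoc,
      inv_mul_cancel₀ (norm_ne_zero_iff.2 hy0), one_mul, abs_norm] at h
    exact mem_closedBall_zero_iff.2 h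
  simpa using closure_minimal hsub Metric.isClosed_closedBall (frontier_subset_closure hz)

lemma exists_le_inner_of_mem_frontier_polar (hK : Bornology.IsBounded K)
    (hneg : ∀ v ∈ K, -v ∈ K) {θ : ℝ} (hθ : θ < 1) (hz : z ∈ frontier ((innerₗ E).polar K)) :
    ∃ v ∈ K, θ ≤ inner ℝ v z := by
  by_contra! hcon
  obtain ⟨R, hR0, hR⟩ := hK.exists_pos_norm_le
  refine hz.2 (mem_interior_iff_mem_nhds.2 (Filter.mem_of_superset
    (Metric.ball_mem_nhds z (div_pos (sub_pos.2 hθ) hR0)) fun y hy v hv => ?_))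
  have hvz : |inner ℝ v z| ≤ θ := by
    refine abs_le'.2 ⟨(hcon v hv).le, ?_⟩
    rw [← inner_neg_left]
    exact (hcon _ (hneg v hv)).le
  have hvy : |inner ℝ v (y - z)| ≤ 1 - θ := calc
    |inner ℝ v (y - z)| ≤ ‖v‖ * ‖y - z‖ := abs_real_inner_le_norm _ _
    _ ≤ R * ((1 - θ) / R) :=
      mul_le_mul (hR v hv) (mem_ball_iff_norm.1 hy).le (norm_nonneg _) hR0.le
    _ = 1 - θ := mul_div_cancel₀ _ hR0.ne'
  calc |inner ℝ v y| = |inner ℝ v z + inner ℝ v (y - z)| := by rw [← inner_add_right]; congr 2; abel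
    _ ≤ |inner ℝ v z| + |inner ℝ v (y - z)| := abs_add_le _ _
    _ ≤ 1 := by linarith

lemma exists_smul_mem_frontier_polar {w : E} (hw : w ∈ K) (hwz : 0 < inner ℝ w z) :
    ∃ t : ℝ, t • z ∈ frontier ((innerₗ E).polar K) ∧ |t| * inner ℝ w z ≤ 1 := by
  have hle : ∀ t : ℝ, t • z ∈ (innerₗ E).polar K → |t| * inner ℝ w z ≤ 1 := fun t ht => by
    have h : |inner ℝ w (t • z)| ≤ 1 := ht w hw
    rwa [real_inner_smul_right, abs_mul, abs_of_pos hwz] at h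
  have hcont : Continuous fun t : ℝ => t • z := by fun_prop
  obtain ⟨t, ht⟩ : (frontier ((fun t : ℝ => t • z) ⁻¹' (innerₗ E).polar K)).Nonempty := by
    refine nonempty_frontier_iff.2 ⟨⟨0, ?_⟩, fun huniv => ?_⟩
    · simp
    · have h := hle _ (huniv.ge (Set.mem_univ (2 / inner ℝ w z)))
      rw [abs_of_pos (by positivity), div_mul_cancel₀ _ hwz.ne'] at h
      norm_num at h
  have hsub : frontier ((fun t : ℝ => t • z) ⁻¹' (innerₗ E).polar K) ⊆
      {t | |t| * inner ℝ w z ≤ 1} :=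
    frontier_subset_closure.trans
      (closure_minimal hle (isClosed_le (by fun_prop) continuous_const))
  exact ⟨t, hcont.frontier_preimage_subset _ ht, hsub ht⟩

lemma exists_forall_abs_inner_lt_of_notMem_absConvexHull [CompleteSpace E] {S : Set E}
    (hS : S.Finite) {x : E} (hx : x ∉ absConvexHull ℝ S) :
    ∃ z : E, ∀ y ∈ S, |inner ℝ z y| < inner ℝ z x := by
  have hclosed : IsClosed (absConvexHull ℝ S) := by
    rw [← convexHull_union_neg_eq_absConvexHull]
    exact ((hS.union hS.neg).isCompact_convexHull ℝ).isClosed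
  obtain ⟨f, s, hfs, hsx⟩ := geometric_hahn_banach_closed_point convex_absConvexHull hclosed hx
  refine ⟨(InnerProductSpace.toDual ℝ E).symm f, fun y hy => ?_⟩
  simp only [InnerProductSpace.toDual_symm_apply]
  have hy' := subset_absConvexHull (𝕜 := ℝ) hy
  refine (abs_lt.2 ⟨?_, hfs y hy'⟩).trans hsx
  rw [neg_lt, ← map_neg]
  exact hfs _ (balanced_absConvexHull.neg_mem_iff.2 hy')

lemma smul_subset_absConvexHull_of_frontier_polar [CompleteSpace E] {S : Set E} (hS : S.Finite)
    (hne : S.Nonempty) {c : ℝ} (hc : 0 < c)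
    (h : ∀ z ∈ frontier ((innerₗ E).polar K), ∃ y ∈ S, c ≤ |inner ℝ z y|) :
    c • K ⊆ absConvexHull ℝ S := by
  rintro _ ⟨w, hw, rfl⟩
  by_contra hcon
  obtain ⟨z, hz⟩ := exists_forall_abs_inner_lt_of_notMem_absConvexHull hS hcon
  simp only [inner_smul_right, real_inner_comm w] at hz
  have hwz : 0 < inner ℝ w z :=
    pos_of_mul_pos_right ((abs_nonneg _).trans_lt (hz _ hne.some_mem)) hc.le
  obtain ⟨t, ht, htw⟩ := exists_smul_mem_frontier_polar hw hwz
  obtain ⟨y, hy, hcy⟩ := h _ ht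
  rw [real_inner_smul_left, abs_mul] at hcy
  have ht0 : 0 < |t| := pos_of_mul_pos_left (hc.trans_le hcy) (abs_nonneg _)
  refine hcy.not_gt ?_
  calc |t| * |inner ℝ z y| < |t| * (c * inner ℝ w z) := mul_lt_mul_of_pos_left (hz y hy) ht0
    _ = c * (|t| * inner ℝ w z) := mul_left_comm _ _ _
    _ ≤ c := mul_le_of_le_one_right hc.le htw

end Polar

section Body

variable {N n : ℕ} {v z : EuclideanSpace ℝ (Fin n)}

lemma inner_eq_dotProduct (x y : EuclideanSpace ℝ (Fin n)) :
    inner ℝ x y = WithLp.ofLp x ⬝ᵥ WithLp.ofLp y := by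
  simp [PiLp.inner_apply, dotProduct, mul_comm]

lemma mem_body_iff (hT : 0 ≤ Real.log (Real.exp 1 * N / n)) :
    v ∈ body N n ↔ (∀ j, |v j| ≤ 1) ∧ ‖v‖ ^ 2 ≤ Real.log (Real.exp 1 * N / n) := by
  rw [body, euclideanBall, smul_unitClosedBall_of_nonneg (Real.sqrt_nonneg _)]
  refine and_congr Iff.rfl ?_
  rw [mem_closedBall_zero_iff, Real.le_sqrt (norm_nonneg _) hT]

lemma neg_mem_body (hT : 0 ≤ Real.log (Real.exp 1 * N / n)) (hv : v ∈ body N n) :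
    -v ∈ body N n := by
  rw [mem_body_iff hT] at hv ⊢
  simpa using hv

lemma isBounded_body (N n : ℕ) : Bornology.IsBounded (body N n) :=
  (Metric.isBounded_closedBall.smul₀ _).subset Set.inter_subset_right

lemma closedBall_subset_body (hT : 1 ≤ Real.log (Real.exp 1 * N / n)) :
    Metric.closedBall 0 1 ⊆ body N n := fun v hv => by
  rw [mem_closedBall_zero_iff] at hv
  exact (mem_body_iff (zero_le_one.trans hT)).2
    ⟨fun j => (PiLp.norm_apply_le v j).trans hv, (pow_le_one₀ (norm_nonneg _) hv).trans hT⟩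

lemma norm_le_one_of_mem_frontier_dualBody (hT : 1 ≤ Real.log (Real.exp 1 * N / n))
    (hz : z ∈ frontier (dualBody N n)) : ‖z‖ ≤ 1 :=
  norm_le_one_of_mem_frontier_polar (closedBall_subset_body hT) hz

lemma exists_mem_body_half_le_inner (hT : 0 ≤ Real.log (Real.exp 1 * N / n))
    (hz : z ∈ frontier (dualBody N n)) : ∃ v ∈ body N n, 1 / 2 ≤ inner ℝ v z :=
  exists_le_inner_of_mem_frontier_polar (isBounded_body N n) (fun _ => neg_mem_body hT)
    (by norm_num) hz

end Body

section Law

section Map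

variable {Ω : Type*} [MeasurableSpace Ω] {P : Measure Ω} {ξ : Ω → ℝ}

lemma IsSymmetric.isNegInvariant_map (hs : IsSymmetric ξ P) : (P.map ξ).IsNegInvariant where
  neg_eq_self := by
    rw [Measure.neg, AEMeasurable.map_map_of_aemeasurable (by fun_prop) hs.aemeasurable_fst]
    exact hs.map_eq.symm

lemma memLp_id_two_map_of_variance_ne_zero [IsFiniteMeasure P] (hξ : AEMeasurable ξ P)
    (hv : variance ξ P ≠ 0) : MemLp id 2 (P.map ξ) :=
  (memLp_map_measure_iff (by fun_prop) hξ).2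
    (memLp_two_of_variance_ne_zero hξ.aestronglyMeasurable hv)

lemma IsSymmetric.integral_eq_zero (hs : IsSymmetric ξ P) : ∫ ω, ξ ω ∂P = 0 := by
  have h : ∫ ω, ξ ω ∂P = ∫ ω, -ξ ω ∂P := hs.integral_eq
  rw [integral_neg] at h
  linarith

lemma IsSymmetric.integral_sq_map (hs : IsSymmetric ξ P) :
    ∫ x, x ^ 2 ∂P.map ξ = variance ξ P := by
  rw [integral_map hs.aemeasurable_fst (by fun_prop),
    variance_of_integral_eq_zero hs.aemeasurable_fst hs.integral_eq_zero]

lemma SmallBall.le_measureReal_map {κ δ : ℝ} (h : SmallBall ξ P κ δ) (hξ : AEMeasurable ξ P) :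
    δ ≤ (P.map ξ).real {x | κ ≤ |x|} := by
  rw [map_measureReal_apply_of_aemeasurable hξ (measurableSet_le measurable_const (by fun_prop))]
  exact h

end Map

section RandomMatrix

variable {Ω Ω' : Type*} [MeasurableSpace Ω] [MeasurableSpace Ω'] {N n : ℕ}
  {Γ : Ω → Matrix (Fin N) (Fin n) ℝ} {P : Measure Ω}
  {ξ : Ω' → ℝ} {P' : Measure Ω'} [IsProbabilityMeasure P']

lemma HasIIDEntries.map_eq (h : HasIIDEntries Γ P ξ P') (hξ : AEMeasurable ξ P') :
    P.map (fun ω i j => Γ ω i j)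
      = Measure.pi fun _ : Fin N => Measure.pi fun _ : Fin n => P'.map ξ := by
  have : IsProbabilityMeasure (P'.map ξ) := Measure.isProbabilityMeasure_map hξ
  have hΓ : ∀ p : Fin N × Fin n, AEMeasurable (fun ω => Γ ω p.1 p.2) P :=
    fun p => (h.identDistrib p.1 p.2).aemeasurable_fst
  have hjoint := h.indep.map_fun_eq_pi_map hΓ
  simp only [(h.identDistrib _ _).map_eq] at hjoint
  have hcurry := Measure.infinitePi_map_curry fun (_ : Fin N) (_ : Fin n) => P'.map ξ
  simp only [Measure.infinitePi_eq_pi] at hcurry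
  rw [← hcurry, ← hjoint, AEMeasurable.map_map_of_aemeasurable
    (MeasurableEquiv.measurable _).aemeasurable (aemeasurable_pi_lambda _ hΓ)]
  rfl

lemma HasIIDEntries.measureReal_notMem [IsProbabilityMeasure P] (h : HasIIDEntries Γ P ξ P')
    (hξ : AEMeasurable ξ P') {B : Set (Fin N → Fin n → ℝ)} (hB : MeasurableSet B) :
    P.real {ω | Γ ω ∉ B}
      = 1 - (Measure.pi fun _ : Fin N => Measure.pi fun _ : Fin n => P'.map ξ).real B := by
  have hΓ : AEMeasurable (fun ω i j => Γ ω i j) P :=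
    aemeasurable_pi_lambda _ fun i => aemeasurable_pi_lambda _ fun j =>
      (h.identDistrib i j).aemeasurable_fst
  rw [← h.map_eq hξ, map_measureReal_apply_of_aemeasurable hΓ hB,
    ← probReal_compl_eq_one_sub₀ (hΓ.nullMeasurableSet_preimage hB)]
  rfl

end RandomMatrix

variable {ι : Type*} [Fintype ι] {μ : Measure ℝ} [IsProbabilityMeasure μ]

lemma measureReal_pi_mul_card_le_dotProduct_self_le [Nonempty ι] (hμ : MemLp id 2 μ)
    (hμ1 : ∫ x, x ^ 2 ∂μ = 1) {A : ℝ} (hA : 0 < A) :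
    (Measure.pi fun _ : ι => μ).real {x | A * Fintype.card ι ≤ x ⬝ᵥ x} ≤ 1 / A := by
  simp only [dotProduct, ← sq]
  have hint (i : ι) : Integrable (fun x : ι → ℝ => x i ^ 2) (Measure.pi fun _ => μ) :=
    integrable_comp_eval (μ := fun _ : ι => μ) (i := i) hμ.integrable_sq
  have hmean (i : ι) : ∫ x : ι → ℝ, x i ^ 2 ∂(Measure.pi fun _ => μ) = 1 := by
    rw [← hμ1]
    exact integral_comp_eval (μ := fun _ : ι => μ) (i := i) (f := fun y : ℝ => y ^ 2)
      (by fun_prop)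
  have hsum : ∫ x : ι → ℝ, ∑ i, x i ^ 2 ∂(Measure.pi fun _ => μ) = Fintype.card ι := by
    simp [integral_finsetSum _ fun i _ => hint i, hmean]
  have hmarkov := mul_meas_ge_le_integral_of_nonneg
    (Filter.Eventually.of_forall fun x => Finset.sum_nonneg fun i _ => sq_nonneg (x i))
    (integrable_finsetSum Finset.univ fun i _ => hint i) (A * Fintype.card ι)
  rw [hsum, mul_right_comm] at hmarkov
  rw [le_div_iff₀' hA]
  exact (mul_le_iff_le_one_left (by positivity)).1 hmarkov

lemma le_measureReal_le_abs_dotProduct [μ.IsNegInvariant] (hμ : MemLp id 2 μ)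
    (hμ1 : ∫ x, x ^ 2 ∂μ = 1) {κ δ : ℝ} (hκ : 0 ≤ κ) (hδ0 : 0 ≤ δ)
    (hδ : δ ≤ μ.real {x | κ ≤ |x|}) {η θ : ℝ} (hη0 : 0 ≤ η) (hη1 : η ≤ 1) (hθ : 0 ≤ θ)
    {v y : ι → ℝ} (hv : ∀ i, |v i| ≤ 1) (hvy : θ ≤ v ⬝ᵥ y) {T V : ℝ} (hvT : v ⬝ᵥ v ≤ T)
    (hyV : y ⬝ᵥ y ≤ V) :
    ((κ * δ * (η * θ)) ^ 2 / (4 * ((κ * δ * (η * θ)) ^ 2 + V))) ^ 2 * Real.exp (-(η ^ 2 * T))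
      ≤ (Measure.pi fun _ : ι => μ).real {x | κ * δ * (η * θ) / 2 ≤ |y ⬝ᵥ x|} := by
  have hηv : ∀ i, |(η • v) i| ≤ 1 := fun i => by
    rw [Pi.smul_apply, smul_eq_mul, abs_mul, abs_of_nonneg hη0]
    exact mul_le_one₀ hη1 (abs_nonneg _) (hv i)
  have hηvy : η * θ ≤ (η • v) ⬝ᵥ y := by
    rw [smul_dotProduct, smul_eq_mul]
    exact mul_le_mul_of_nonneg_left hvy hη0
  have hηvT : (η • v) ⬝ᵥ (η • v) ≤ η ^ 2 * T := by
    rw [smul_dotProduct, dotProduct_smul, smul_eq_mul, smul_eq_mul, ← mul_assoc, ← sq]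
    gcongr
  have htail := le_measureReal_dotProduct hμ hμ1 hκ hδ hηv
    ((mul_nonneg hη0 hθ).trans hηvy) (by positivity : 0 ≤ κ * δ * (η * θ)) (by gcongr) hyV
  refine le_trans (by gcongr) (htail.trans (measureReal_mono fun x hx => ?_))
  exact le_trans hx (le_abs_self (y ⬝ᵥ x))

end Law

section AspectRatio

open Filter Topology

variable {α : ℝ}

lemma eventually_four_mul_rpow_neg_le (hα : 0 < α) {b : ℝ} (hb : 0 < b) :
    ∀ᶠ x : ℝ in atTop, 4 * x ^ (-α) ≤ b * Real.exp (-(α / 2 * (1 + Real.log x))) := by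
  filter_upwards [(tendsto_rpow_neg_atTop (half_pos hα)).eventually_le_const
    (by positivity : 0 < b * Real.exp (-(α / 2)) / 4), eventually_gt_atTop 0] with x hx hx0
  calc 4 * x ^ (-α) = 4 * x ^ (-(α / 2)) * x ^ (-(α / 2)) := by
        rw [mul_assoc, ← Real.rpow_add hx0, ← neg_add, add_halves]
    _ ≤ 4 * (b * Real.exp (-(α / 2)) / 4) * x ^ (-(α / 2)) := by gcongr
    _ = b * Real.exp (-(α / 2 * (1 + Real.log x))) := by
        rw [mul_div_cancel₀ _ (four_ne_zero' ℝ), mul_assoc, Real.rpow_def_of_pos hx0,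
          ← Real.exp_add]
        ring_nf

lemma tendsto_one_add_log_mul_sq_rpow_neg (hα : 0 < α) (a : ℝ) :
    Tendsto (fun x : ℝ => (1 + Real.log x) * (a * x ^ (-α)) ^ 2) atTop (𝓝 0) := by
  have hneg : Tendsto (fun x : ℝ => x ^ (-α)) atTop (𝓝 0) := tendsto_rpow_neg_atTop hα
  have hlog : Tendsto (fun x : ℝ => Real.log x / x ^ α) atTop (𝓝 0) :=
    (isLittleO_log_rpow_atTop hα).tendsto_div_nhds_zero
  have h : Tendsto (fun x : ℝ => a ^ 2 * ((x ^ (-α) + Real.log x / x ^ α) * x ^ (-α)))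
      atTop (𝓝 0) := by
    simpa using ((hneg.add hlog).mul hneg).const_mul (a ^ 2)
  refine h.congr' ?_
  filter_upwards [eventually_gt_atTop 0] with x hx
  rw [Real.rpow_neg hx.le]
  ring

lemma eventually_one_add_log_div_rpow_neg_le (hα : α < 1) {b : ℝ} (hb : 0 < b) :
    ∀ᶠ x : ℝ in atTop, 1 + Real.log (b / x ^ (-α)) ≤ x * x ^ (-α) / 5 := by
  have hlog : Tendsto (fun x : ℝ => Real.log x / x ^ (1 - α)) atTop (𝓝 0) :=
    (isLittleO_log_rpow_atTop (sub_pos.2 hα)).tendsto_div_nhds_zero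
  have hinv : Tendsto (fun x : ℝ => (x ^ (1 - α))⁻¹) atTop (𝓝 0) :=
    (tendsto_rpow_atTop (sub_pos.2 hα)).inv_tendsto_atTop
  have h : Tendsto (fun x : ℝ => (1 + Real.log b) * (x ^ (1 - α))⁻¹ +
      α * (Real.log x / x ^ (1 - α))) atTop (𝓝 0) := by
    simpa using (hinv.const_mul _).add (hlog.const_mul α)
  filter_upwards [h.eventually_le_const (by norm_num : (0 : ℝ) < 1 / 5), eventually_gt_atTop 0]
    with x hx hx0
  have hxx : x * x ^ (-α) = x ^ (1 - α) := by
    rw [sub_eq_add_neg, Real.rpow_add hx0, Real.rpow_one]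
  have hpos : 0 < x ^ (1 - α) := Real.rpow_pos_of_pos hx0 _
  rw [hxx, Real.log_div hb.ne' (Real.rpow_pos_of_pos hx0 _).ne', Real.log_rpow hx0]
  rw [← div_eq_mul_inv, ← mul_div_assoc, ← add_div, div_le_iff₀ hpos] at hx
  linarith

lemma mul_div_rpow_neg_eq (α : ℝ) {x y : ℝ} (hx : 0 < x) (hy : 0 < y) :
    x * (x / y) ^ (-α) = x ^ (1 - α) * y ^ α := by
  rw [Real.div_rpow hx.le hy.le, Real.rpow_neg hy.le, div_inv_eq_mul, sub_eq_add_neg,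
    Real.rpow_add hx, Real.rpow_one, mul_assoc]

end AspectRatio

section RandomRows

variable {μ : Measure ℝ} [IsProbabilityMeasure μ] [μ.IsNegInvariant] {κ δ : ℝ} {N n : ℕ}

lemma exists_measurableSet_forall_frontier_dualBody (hμ : MemLp id 2 μ)
    (hμ1 : ∫ x, x ^ 2 ∂μ = 1) (hκ : 0 ≤ κ) (hδ0 : 0 ≤ δ) (hδ : δ ≤ μ.real {x | κ ≤ |x|})
    (hn : 0 < n) {T : ℝ} (hT : Real.log (Real.exp 1 * N / n) = T) (hT1 : 1 ≤ T) {η c u : ℝ}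
    (hη0 : 0 ≤ η) (hη1 : η ≤ 1) (hc : 0 < c) (hηc : κ * δ * η = 16 * c) (hu : 0 < u)
    (hub : 4 * u ≤ (c ^ 2 / (4 * c ^ 2 + 1)) ^ 2 * Real.exp (-(η ^ 2 * T))) (hcu : c * u / 4 ≤ 1)
    (hTu : T * (c * u / 4) ^ 2 ≤ 1 / 16)
    (hnet : n * (1 + Real.log (6 / (c * u / 4))) ≤ N * u / 5) :
    ∃ B : Set (Fin N → Fin n → ℝ), MeasurableSet B ∧
      (Measure.pi fun _ : Fin N => Measure.pi fun _ : Fin n => μ).real B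
        ≤ 2 * Real.exp (-(N * u / 5)) ∧
      ∀ Γ ∉ B, ∀ z ∈ frontier (dualBody N n),
        N * u ≤ ({i | c ≤ |inner ℝ z (rowVec Γ i)|}.ncard : ℝ) := by
  have : Nonempty (Fin n) := Fin.pos_iff_nonempty.1 hn
  set K : Set (Fin n → ℝ) := {v | (∀ j, |v j| ≤ 1) ∧ v ⬝ᵥ v ≤ T}
  have hlong : (Measure.pi fun _ : Fin n => μ).real {x | 8 / u * n ≤ x ⬝ᵥ x} ≤ u / 8 := by
    simpa using measureReal_pi_mul_card_le_dotProduct_self_le (ι := Fin n) hμ hμ1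
      (by positivity : 0 < 8 / u)
  have htail (y : Fin n → ℝ) (hy : y ⬝ᵥ y ≤ 4) (hv : ∃ v ∈ K, 1 / 4 ≤ v ⬝ᵥ y) :
      4 * u ≤ (Measure.pi fun _ : Fin n => μ).real {x | 2 * c ≤ |y ⬝ᵥ x|} := by
    obtain ⟨v, ⟨hv1, hvT⟩, hvy⟩ := hv
    have h := le_measureReal_le_abs_dotProduct hμ hμ1 hκ hδ0 hδ hη0 hη1 (by norm_num) hv1 hvy hvT hy
    have hmean : κ * δ * (η * (1 / 4)) = 4 * c := by linear_combination hηc / 4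
    have hb : (4 * c) ^ 2 / (4 * ((4 * c) ^ 2 + 4)) = c ^ 2 / (4 * c ^ 2 + 1) := by
      rw [div_eq_div_iff (by positivity) (by positivity)]
      ring
    rw [hmean, hb, show 4 * c / 2 = 2 * c by ring] at h
    exact hub.trans h
  obtain ⟨B, hBm, hBP, hB⟩ := exists_measurableSet_forall_mul_le_ncard (ι' := Fin N) hu hc hcu hTu
    (by simpa using hnet) (by simpa using hlong) (fun _ hv => hv.2) htail
  simp only [Fintype.card_fin] at hBP hB
  refine ⟨B, hBm, hBP, fun Γ hΓ z hz => ?_⟩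
  subst hT
  obtain ⟨v, hv, hvz⟩ := exists_mem_body_half_le_inner (zero_le_one.trans hT1) hz
  rw [mem_body_iff (zero_le_one.trans hT1), ← real_inner_self_eq_norm_sq] at hv
  have hz1 := pow_le_one₀ (n := 2) (norm_nonneg z) (norm_le_one_of_mem_frontier_dualBody hT1 hz)
  rw [← real_inner_self_eq_norm_sq] at hz1
  simp only [inner_eq_dotProduct] at hv hvz hz1 ⊢
  exact hB Γ hΓ z hz1 ⟨v, hv, hvz⟩

end RandomRows

section Main

open Filter

variable {κ δ α : ℝ}

lemma exists_aspectRatio (hα0 : 0 < α) (hα1 : α < 1) {b c : ℝ} (hb : 0 < b) (hc : 0 < c) :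
    ∃ x₀ : ℝ, 1 ≤ x₀ ∧ ∀ x, x₀ ≤ x →
      4 * x ^ (-α) ≤ b * Real.exp (-(α / 2 * (1 + Real.log x))) ∧
      c * x ^ (-α) / 4 ≤ 1 ∧
      (1 + Real.log x) * (c * x ^ (-α) / 4) ^ 2 ≤ 1 / 16 ∧
      1 + Real.log (6 / (c * x ^ (-α) / 4)) ≤ x * x ^ (-α) / 5 := by
  have hcu : ∀ x : ℝ, c * x ^ (-α) / 4 = c / 4 * x ^ (-α) := fun x => by ring
  have hnet : ∀ x : ℝ, 6 / (c / 4 * x ^ (-α)) = 24 / c / x ^ (-α) := fun x => by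
    rw [← div_div]
    congr 1
    field_simp
    norm_num
  have hsmall : ∀ᶠ x : ℝ in atTop, c / 4 * x ^ (-α) ≤ 1 := by
    have h := (tendsto_rpow_neg_atTop hα0).const_mul (c / 4)
    rw [mul_zero] at h
    exact h.eventually_le_const one_pos
  obtain ⟨x₀, hx₀⟩ := ((eventually_four_mul_rpow_neg_le hα0 hb).and (hsmall.and
    (((tendsto_one_add_log_mul_sq_rpow_neg hα0 (c / 4)).eventually_le_const
      (by norm_num : (0 : ℝ) < 1 / 16)).and (eventually_one_add_log_div_rpow_neg_le hα1
        (by positivity : 0 < 24 / c))))).exists_forall_of_atTop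
  refine ⟨max 1 x₀, le_max_left _ _, fun x hx => ?_⟩
  simp only [hcu, hnet]
  exact hx₀ x ((le_max_right _ _).trans hx)

lemma exists_forall_exists_measurableSet_frontier_dualBody (hκ : 0 < κ) (hδ : 0 < δ)
    (hα0 : 0 < α) (hα1 : α < 1) :
    ∃ c x₀ : ℝ, 0 < c ∧ 0 < x₀ ∧ ∀ (μ : Measure ℝ) [IsProbabilityMeasure μ] [μ.IsNegInvariant],
      MemLp id 2 μ → ∫ x, x ^ 2 ∂μ = 1 → δ ≤ μ.real {x | κ ≤ |x|} →
      ∀ {N n : ℕ}, 0 < n → x₀ * n ≤ N → ∃ B : Set (Fin N → Fin n → ℝ), MeasurableSet B ∧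
        (Measure.pi fun _ : Fin N => Measure.pi fun _ : Fin n => μ).real B
          ≤ 2 * Real.exp (-(1 / 5 * (N : ℝ) ^ (1 - α) * (n : ℝ) ^ α)) ∧
        ∀ Γ ∉ B, ∀ z ∈ frontier (dualBody N n), (N : ℝ) ^ (1 - α) * (n : ℝ) ^ α
          ≤ ({i | c ≤ |inner ℝ z (rowVec Γ i)|}.ncard : ℝ) := by
  set η := √(α / 2)
  have hη0 : 0 < η := Real.sqrt_pos.2 (half_pos hα0)
  have hη1 : η ≤ 1 := Real.sqrt_le_one.2 (by linarith)
  have hηsq : η ^ 2 = α / 2 := Real.sq_sqrt (half_pos hα0).le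
  set c := κ * δ * η / 16
  have hc : 0 < c := by positivity
  obtain ⟨x₀, hx₀1, hx₀⟩ := exists_aspectRatio hα0 hα1
    (by positivity : 0 < (c ^ 2 / (4 * c ^ 2 + 1)) ^ 2) hc
  refine ⟨c, x₀, hc, one_pos.trans_le hx₀1, fun μ _ _ hμ hμ1 hsb N n hn hNn => ?_⟩
  have hn0 : (0 : ℝ) < n := Nat.cast_pos.2 hn
  have hN0 : (0 : ℝ) < N := (mul_pos (one_pos.trans_le hx₀1) hn0).trans_le hNn
  have hx : x₀ ≤ N / n := (le_div_iff₀ hn0).2 hNn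
  have hx1 : 1 ≤ (N : ℝ) / n := hx₀1.trans hx
  have hlog : Real.log (Real.exp 1 * N / n) = 1 + Real.log (N / n) := by
    rw [mul_div_assoc, Real.log_mul (Real.exp_ne_zero _) (by positivity), Real.log_exp]
  obtain ⟨hub, hcu, hTu, hnet⟩ := hx₀ _ hx
  have hnet' := mul_le_mul_of_nonneg_left hnet hn0.le
  rw [mul_div_assoc', ← mul_assoc, mul_div_cancel₀ _ hn0.ne'] at hnet'
  obtain ⟨B, hBm, hBP, hB⟩ := exists_measurableSet_forall_frontier_dualBody hμ hμ1 hκ.le hδ.le hsb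
    hn hlog (by linarith [Real.log_nonneg hx1]) hη0.le hη1 hc
    (mul_div_cancel₀ _ (by norm_num)).symm (Real.rpow_pos_of_pos (by positivity) _)
    (by rwa [hηsq]) hcu hTu hnet'
  rw [mul_div_rpow_neg_eq α hN0 hn0] at hBP hB
  rw [div_eq_inv_mul, ← mul_assoc, ← one_div] at hBP
  exact ⟨B, hBm, hBP, hB⟩

end Main

end RandomPolytope

theorem theorem1p4 (κ δ α : ℝ) (hκ : 0 < κ) (hδ : 0 < δ) (hα0 : 0 < α) (hα1 : α < 1) :
    ∃ c₀ c₁ c₂ c₃ : ℝ, 0 < c₀ ∧ 0 < c₁ ∧ 0 < c₂ ∧ 0 < c₃ ∧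
      ∀ {Ω' : Type*} [MeasurableSpace Ω'] (P' : Measure Ω') [IsProbabilityMeasure P']
        (ξ : Ω' → ℝ),
        RandomPolytope.IsSymmetric ξ P' → variance ξ P' = 1 →
        RandomPolytope.SmallBall ξ P' κ δ →
      ∀ {Ω : Type*} [MeasurableSpace Ω] (P : Measure Ω) [IsProbabilityMeasure P]
        (N n : ℕ) (Γ : Ω → Matrix (Fin N) (Fin n) ℝ),
        RandomPolytope.HasIIDEntries Γ P ξ P' → 0 < n → c₁ * (n : ℝ) ≤ (N : ℝ) →
        1 - 2 * Real.exp (-(c₂ * (N : ℝ) ^ (1 - α) * (n : ℝ) ^ α)) ≤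
          P.real {ω |
            c₃ • RandomPolytope.body N n ⊆
              absConvexHull ℝ (Set.range (RandomPolytope.rowVec (Γ ω))) ∧
            ∀ z ∈ frontier (RandomPolytope.dualBody N n),
              (N : ℝ) ^ (1 - α) * (n : ℝ) ^ α ≤
                ({i : Fin N | c₀ ≤ |inner ℝ z (RandomPolytope.rowVec (Γ ω) i)|}.ncard : ℝ)} := by
  obtain ⟨c, x₀, hc, hx₀, hbad⟩ :=
    RandomPolytope.exists_forall_exists_measurableSet_frontier_dualBody hκ hδ hα0 hα1
  refine ⟨c, x₀, 1 / 5, c, hc, hx₀, by norm_num, hc, ?_⟩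
  intro Ω' _ P' _ ξ hsymm hvar hsb Ω _ P _ N n Γ hΓ hn hNn
  have hξ : AEMeasurable ξ P' := hsymm.aemeasurable_fst
  have : IsProbabilityMeasure (P'.map ξ) := Measure.isProbabilityMeasure_map hξ
  have : (P'.map ξ).IsNegInvariant := hsymm.isNegInvariant_map
  obtain ⟨B, hB, hPB, hcount⟩ := hbad (P'.map ξ)
    (RandomPolytope.memLp_id_two_map_of_variance_ne_zero hξ (hvar ▸ one_ne_zero))
    (hsymm.integral_sq_map.trans hvar) (hsb.le_measureReal_map hξ) hn hNn
  have hn0 : (0 : ℝ) < n := Nat.cast_pos.2 hn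
  have hN0 : (0 : ℝ) < N := (mul_pos hx₀ hn0).trans_le hNn
  refine (sub_le_sub_left hPB 1).trans ((hΓ.measureReal_notMem hξ hB).ge.trans
    (measureReal_mono fun ω hω => ⟨?_, hcount (Γ ω) hω⟩))
  have : Nonempty (Fin N) := Fin.pos_iff_nonempty.1 (Nat.cast_pos.1 hN0)
  refine RandomPolytope.smul_subset_absConvexHull_of_frontier_polar (Set.finite_range _)
    (Set.range_nonempty _) hc fun z hz => Set.exists_range_iff.2 ?_
  exact (Set.ncard_pos).1 (Nat.cast_pos.1 (lt_of_lt_of_le (by positivity) (hcount (Γ ω) hω z hz)))
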